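/- Let $\Gamma$ be a totally ordered abelian group with positive cone $\Gamma^+=\{x\in\Gamma: x\ge 0\}$, let $\mathcal A$ be a unital $C^*$-algebra, and let $\alpha:\Gamma^+\to\mathrm{End}(\mathcal A)$ be an action by (not necessarily unital) $*$-endomorphisms, i.e. $\alpha_0=\mathrm{Id}$ and $\alpha_x\circ\alpha_y=\alpha_{x+y}$ for all $x,y\in\Gamma^+$. Suppose that $(\mathcal A,\Gamma^+,\alpha)$ is finely representable: there are a Hilbert space $K$, a faithful non-degenerate representation $\sigma:\mathcal A\to L(K)$ and a semigroup homomorphism $V:\Gamma^+\to L(K)$ such that $\sigma(\alpha_x(a))=V_x\sigma(a)V_x^*$, $V_x^*\sigma(a)V_x\in\sigma(\mathcal A)$ and $V_x\sigma(a)=\sigma(\alpha_x(a))V_x$ for all $a\in\mathcal A$, $x\in\Gamma^+$. Then there is a unique complete transfer action $L$ for $\alpha$, i.e. a family of continuous linear positive maps $L_x:\mathcal A\to\mathcal A$ ($x\in\Gamma^+$) with $L_{x+y}=L_y\circ L_x$, $L_x(\alpha_x(a)b)=aL_x(b)$ and $\alpha_x(L_x(a))=\alpha_x(1)\,a\,\alpha_x(1)$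 for all $a,b\in\mathcal A$, $x,y\in\Gamma^+$. Let $l_1(\Gamma,\alpha,\mathcal A)$ be the unital Banach $*$-algebra of families $a=(a_g)_{g\in\Gamma}$ in $\mathcal A$ with $a_x\in\mathcal A\alpha_x(1)$, $a_{-x}\in\alpha_x(1)\mathcal A$ for $x\in\Gamma^+$ and $\|a\|=\sum_{g}\|a_g\|<\infty$, with coordinatewise linear operations, involution $(a^*)_g=(a_{-g})^*$ and product $$(ab)_g=\begin{cases}\displaystyle\sum_{\substack{g=x-y\\x,y>0}}a_x\alpha_{x-y}(b_{-y})+\sum_{\substack{g=y-x\\x,y>0}}L_x(a_{-x}b_y)+\sum_{\substack{g=x+y\\x,y\ge0}}a_x\alpha_x(b_y),&g\ge0,\\[2ex]\displaystyle\sum_{\substack{g=x-y\\x,y>0}}\alpha_{y-x}(a_x)b_{-y}+\sum_{\substack{g=y-x\\x,y>0}}L_y(a_{-x}b_y)+\sum_{\substack{g=-x-y\\x,y\ge0}}\alpha_y(a_{-x})b_{-y},&g<0,\end{cases}$$ and let the crossed product $\mathcal A\rtimes_\alpha\Gamma$ be the enveloping $C^*$-algebra of $l_1(\Gamma,\alpha,\mathcal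 A)$. Write $a\delta_g$ for the family whose only possibly non-zero coefficient is $a$, at $g$; write $a$ again for the image of $a\delta_0$ ($a\in\mathcal A$) in $\mathcal A\rtimes_\alpha\Gamma$, and $u_x$ for the image of $\alpha_x(1)\delta_x$ ($x\in\Gamma^+$). Let $(\pi,U,H)$ be a covariant representation: $H$ is a Hilbert space, $\pi:\mathcal A\to L(H)$ is a non-degenerate representation and $U:\Gamma^+\to L(H)$ is a semigroup homomorphism with $U_x\pi(a)U_x^*=\pi(\alpha_x(a))$ and $U_x^*\pi(a)U_x=\pi(L_x(a))$ for all $a\in\mathcal A$, $x\in\Gamma^+$. Let $\pi\times U$ be the representation of $\mathcal A\rtimes_\alpha\Gamma$ on $H$ that extends the representation $$(a_g)_{g\in\Gamma}\mapsto\sum_{x>0}U_x^*\pi(a_{-x})+\pi(a_0)+\sum_{x>0}\pi(a_x)U_x$$ of $l_1(\Gamma,\alpha,\mathcal A)$. **Theorem.** The representation $\pi\times U$ of $\mathcal A\rtimes_\alpha\Gamma$ is faithful if and only if $$\|a_0\|\le\Bigl\|(\pi\times U)\Bigl(\sum_{x\in F}u_x^*a_{-x}+a_0+\sum_{x\in F}a_xu_x\Bigr)\Bigr\|$$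 for every finite set $F\subset\Gamma^+\setminus\{0\}$ and all $a_0\in\mathcal A$, $a_x\in\mathcal A\alpha_x(1)$, $a_{-x}\in\alpha_x(1)\mathcal A$ ($x\in F$). -/

import Mathlib

universe u v w w'

noncomputable section

/-- A C⋆-seminorm on a complex unital `*`-algebra. These are exactly the functions `a ↦ ‖ρ a‖` where
`ρ` is a `*`-representation, that is, a `*`-homomorphism to a C⋆-algebra: see `ofHom` and
`toComplHom` below. -/
structure CStarSeminorm (B : Type*) [Ring B] [StarRing B] [Algebra ℂ B] extends
    Seminorm ℂ B where
  mul_le' : ∀ a b : B, toFun (a * b) ≤ toFun a * toFun b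
  star_mul_self' : ∀ a : B, toFun (star a * a) = toFun a ^ 2

namespace CStarSeminorm

open UniformSpace

section Completion

variable {B : Type*} [Ring B] [StarRing B] [Algebra ℂ B]

theorem mul_le (p : CStarSeminorm B) (a b : B) :
    p.toSeminorm (a * b) ≤ p.toSeminorm a * p.toSeminorm b := p.mul_le' a b

theorem star_mul_self (p : CStarSeminorm B) (a : B) :
    p.toSeminorm (star a * a) = p.toSeminorm a ^ 2 := p.star_mul_self' a

theorem star_le (p : CStarSeminorm B) (a : B) : p.toSeminorm a ≤ p.toSeminorm (star a) := by
  have h1 := p.star_mul_self a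
  have h2 := p.mul_le (star a) a
  rcases (apply_nonneg p.toSeminorm a).eq_or_lt with h | h
  · rw [← h]; exact apply_nonneg _ _
  · nlinarith

theorem star_eq (p : CStarSeminorm B) (a : B) : p.toSeminorm (star a) = p.toSeminorm a :=
  le_antisymm (by simpa using p.star_le (star a)) (p.star_le a)

/-- The algebra `B` with the seminorm `p`. -/
def Pre (_ : CStarSeminorm B) : Type _ := B

instance instSeminormedRingPre (p : CStarSeminorm B) : SeminormedRing p.Pre where
  __ := (inferInstance : Ring B)
  __ := p.toSeminorm.toAddGroupSeminorm.toSeminormedAddCommGroup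
  norm_mul_le := p.mul_le'

instance instAlgebraPre (p : CStarSeminorm B) : Algebra ℂ p.Pre := inferInstanceAs (Algebra ℂ B)
instance instStarRingPre (p : CStarSeminorm B) : StarRing p.Pre := inferInstanceAs (StarRing B)
instance instStarModulePre [StarModule ℂ B] (p : CStarSeminorm B) : StarModule ℂ p.Pre :=
  inferInstanceAs (StarModule ℂ B)

instance instNormedAlgebraPre (p : CStarSeminorm B) : NormedAlgebra ℂ p.Pre where
  norm_smul_le c a := (map_smul_eq_mul p.toSeminorm c a).le

theorem norm_star_pre (p : CStarSeminorm B) (a : p.Pre) : ‖star a‖ = ‖a‖ := p.star_eq a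

theorem uniformContinuous_star_pre (p : CStarSeminorm B) :
    UniformContinuous (star : p.Pre → p.Pre) := by
  refine AddMonoidHomClass.uniformContinuous_of_bound (starAddEquiv : p.Pre ≃+ p.Pre) 1 fun a => ?_
  rw [one_mul]; exact (p.norm_star_pre a).le

/-- The Hausdorff completion of `B` with respect to the C⋆-seminorm `p`. -/
def Compl (p : CStarSeminorm B) : Type _ := Completion p.Pre

instance instNormedRingCompl (p : CStarSeminorm B) : NormedRing p.Compl :=
  inferInstanceAs (NormedRing (Completion p.Pre))
instance instCompleteSpaceCompl (p : CStarSeminorm B) : CompleteSpace p.Compl :=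
  inferInstanceAs (CompleteSpace (Completion p.Pre))
instance instAlgebraCompl (p : CStarSeminorm B) : Algebra ℂ p.Compl :=
  inferInstanceAs (Algebra ℂ (Completion p.Pre))
instance instNormedAlgebraCompl (p : CStarSeminorm B) : NormedAlgebra ℂ p.Compl where
  norm_smul_le c x := norm_smul_le (β := Completion p.Pre) c x

instance instStarCompl (p : CStarSeminorm B) : Star p.Compl :=
  ⟨Completion.map (star : p.Pre → p.Pre)⟩

/-- The canonical map from `B` to the completion. -/
def toCompl (p : CStarSeminorm B) (a : B) : p.Compl := ((show p.Pre from a : p.Pre) : Completion p.Pre)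

theorem continuous_star_compl (p : CStarSeminorm B) : Continuous (star : p.Compl → p.Compl) :=
  Completion.continuous_map

theorem norm_toCompl (p : CStarSeminorm B) (a : B) : ‖p.toCompl a‖ = p.toSeminorm a :=
  Completion.norm_coe (E := p.Pre) a

theorem toCompl_star (p : CStarSeminorm B) (a : B) : p.toCompl (star a) = star (p.toCompl a) :=
  (Completion.map_coe p.uniformContinuous_star_pre _).symm

theorem toCompl_mul (p : CStarSeminorm B) (a b : B) :
    p.toCompl (a * b) = p.toCompl a * p.toCompl b := Completion.coe_mul (α := p.Pre) a b

theorem toCompl_add (p : CStarSeminorm B) (a b : B) :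
    p.toCompl (a + b) = p.toCompl a + p.toCompl b := Completion.coe_add (α := p.Pre) a b

theorem toCompl_smul (p : CStarSeminorm B) (c : ℂ) (a : B) :
    p.toCompl (c • a) = c • p.toCompl a := Completion.coe_smul (X := p.Pre) c a

theorem denseRange_toCompl (p : CStarSeminorm B) : DenseRange p.toCompl :=
  Completion.denseRange_coe (α := p.Pre)

theorem compl_eq (p : CStarSeminorm B) {Y : Type*} [TopologicalSpace Y] [T2Space Y]
    (f g : p.Compl → Y) (hf : Continuous f) (hg : Continuous g)
    (h : ∀ a : B, f (p.toCompl a) = g (p.toCompl a)) (x : p.Compl) : f x = g x :=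
  congrFun (p.denseRange_toCompl.equalizer hf hg (funext h)) x

theorem star_star_compl (p : CStarSeminorm B) (x : p.Compl) : star (star x) = x := by
  have h := p.continuous_star_compl
  refine p.compl_eq (fun x => star (star x)) (fun x => x) (h.comp h) continuous_id
    (fun a => ?_) x
  rw [← toCompl_star, ← toCompl_star, star_star]

theorem star_mul_compl (p : CStarSeminorm B) (x y : p.Compl) :
    star (x * y) = star y * star x := by
  have h := p.continuous_star_compl
  refine p.compl_eq (fun x => star (x * y)) (fun x => star y * star x)
    (h.comp (continuous_id.mul continuous_const)) (continuous_const.mul h) (fun a => ?_) x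
  refine p.compl_eq (fun y => star (p.toCompl a * y)) (fun y => star y * star (p.toCompl a))
    (h.comp (continuous_const.mul continuous_id)) (h.mul continuous_const) (fun b => ?_) y
  rw [← toCompl_star, ← toCompl_star, ← toCompl_mul, ← toCompl_mul, ← toCompl_star, star_mul]

theorem star_add_compl (p : CStarSeminorm B) (x y : p.Compl) :
    star (x + y) = star x + star y := by
  have h := p.continuous_star_compl
  refine p.compl_eq (fun x => star (x + y)) (fun x => star x + star y)
    (h.comp (continuous_id.add continuous_const)) (h.add continuous_const) (fun a => ?_) x
  refine p.compl_eq (fun y => star (p.toCompl a + y)) (fun y => star (p.toCompl a) + star y)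
    (h.comp (continuous_const.add continuous_id)) (continuous_const.add h) (fun b => ?_) y
  rw [← toCompl_star, ← toCompl_star, ← toCompl_add, ← toCompl_add, ← toCompl_star, star_add]

theorem star_smul_compl [StarModule ℂ B] (p : CStarSeminorm B) (c : ℂ) (x : p.Compl) :
    star (c • x) = star c • star x := by
  have h := p.continuous_star_compl
  refine p.compl_eq (fun x => star (c • x)) (fun x => star c • star x)
    (h.comp (continuous_id.const_smul c)) (h.const_smul (star c)) (fun a => ?_) x
  rw [← toCompl_star, ← toCompl_smul, ← toCompl_smul, ← toCompl_star, star_smul]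

theorem norm_star_mul_self_compl (p : CStarSeminorm B) (x : p.Compl) :
    ‖x‖ * ‖x‖ = ‖star x * x‖ := by
  have h := p.continuous_star_compl
  refine p.compl_eq (fun x => ‖x‖ * ‖x‖) (fun x => ‖star x * x‖)
    (continuous_norm.mul continuous_norm) ((h.mul continuous_id).norm) (fun a => ?_) x
  rw [← toCompl_star, ← toCompl_mul, norm_toCompl, norm_toCompl, star_mul_self, sq]

instance instStarRingCompl (p : CStarSeminorm B) : StarRing p.Compl where
  star_involutive := p.star_star_compl
  star_mul := p.star_mul_compl
  star_add := p.star_add_compl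

variable [StarModule ℂ B]

instance instCStarAlgebraCompl (p : CStarSeminorm B) : CStarAlgebra p.Compl where
  norm_mul_self_le := fun x => (p.norm_star_mul_self_compl x).le
  star_smul := p.star_smul_compl

/-- The canonical `*`-homomorphism from `B` to the completion. -/
def toComplHom (p : CStarSeminorm B) : B →⋆ₐ[ℂ] p.Compl where
  toFun := p.toCompl
  map_one' := Completion.coe_one (α := p.Pre)
  map_mul' := p.toCompl_mul
  map_zero' := Completion.coe_zero (α := p.Pre)
  map_add' := p.toCompl_add
  commutes' _ := rfl
  map_star' := p.toCompl_star

end Completion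

section Pullback

variable {B : Type*} [Ring B] [StarRing B] [Algebra ℂ B]

/-- The C⋆-seminorm `a ↦ ‖ρ a‖` of a representation `ρ`. -/
def ofHom {C : Type*} [CStarAlgebra C] (ρ : B →⋆ₐ[ℂ] C) : CStarSeminorm B where
  toFun a := ‖ρ a‖
  map_zero' := by simp
  add_le' a b := by simpa using norm_add_le _ _
  neg' a := by simp
  smul' c a := by simp [norm_smul]
  mul_le' a b := by simpa using norm_mul_le _ _
  star_mul_self' a := by rw [map_mul, map_star, CStarRing.norm_star_mul_self, sq]

instance instNonempty : Nonempty (CStarSeminorm B) :=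
  ⟨{ toSeminorm := 0
     mul_le' := fun _ _ => (mul_zero (0 : ℝ)).ge
     star_mul_self' := fun _ => (zero_pow (M₀ := ℝ) two_ne_zero).symm }⟩

theorem continuous_pre (p : CStarSeminorm B) {C : Type*} [CStarAlgebra C] (ρ : B →⋆ₐ[ℂ] C)
    (h : ∀ a, ‖ρ a‖ ≤ p.toSeminorm a) : Continuous (id (ρ : B →+* C) : p.Pre →+* C) :=
  AddMonoidHomClass.continuous_of_bound (id (ρ : B →+* C) : p.Pre →+* C) 1 fun a => by
    rw [one_mul]; exact h a

/-- The extension to the completion, as a ring homomorphism. -/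
def liftRingHom (p : CStarSeminorm B) {C : Type*} [CStarAlgebra C] (ρ : B →⋆ₐ[ℂ] C)
    (h : ∀ a, ‖ρ a‖ ≤ p.toSeminorm a) : p.Compl →+* C :=
  Completion.extensionHom (id (ρ : B →+* C) : p.Pre →+* C) (p.continuous_pre ρ h)

theorem liftRingHom_toCompl (p : CStarSeminorm B) {C : Type*} [CStarAlgebra C] (ρ : B →⋆ₐ[ℂ] C)
    (h : ∀ a, ‖ρ a‖ ≤ p.toSeminorm a) (a : B) : p.liftRingHom ρ h (p.toCompl a) = ρ a :=
  Completion.extensionHom_coe (α := p.Pre) (id (ρ : B →+* C) : p.Pre →+* C)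
    (p.continuous_pre ρ h) a

theorem continuous_liftRingHom (p : CStarSeminorm B) {C : Type*} [CStarAlgebra C]
    (ρ : B →⋆ₐ[ℂ] C) (h : ∀ a, ‖ρ a‖ ≤ p.toSeminorm a) : Continuous (p.liftRingHom ρ h) :=
  Completion.continuous_extension

/-- The extension of a `*`-homomorphism that is bounded by `p` to the completion. -/
def lift [StarModule ℂ B] (p : CStarSeminorm B) {C : Type*} [CStarAlgebra C] (ρ : B →⋆ₐ[ℂ] C)
    (h : ∀ a, ‖ρ a‖ ≤ p.toSeminorm a) : p.Compl →⋆ₐ[ℂ] C where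
  __ := p.liftRingHom ρ h
  commutes' c := (p.liftRingHom_toCompl ρ h (algebraMap ℂ B c)).trans (AlgHomClass.commutes ρ c)
  map_star' x := by
    have hk := p.continuous_liftRingHom ρ h
    refine p.compl_eq (fun x => p.liftRingHom ρ h (star x)) (fun x => star (p.liftRingHom ρ h x))
      (hk.comp p.continuous_star_compl) hk.star (fun a => ?_) x
    rw [← toCompl_star, liftRingHom_toCompl, liftRingHom_toCompl, map_star]

theorem lift_apply [StarModule ℂ B] (p : CStarSeminorm B) {C : Type*} [CStarAlgebra C]
    (ρ : B →⋆ₐ[ℂ] C) (h : ∀ a, ‖ρ a‖ ≤ p.toSeminorm a) (a : B) :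
    p.lift ρ h (p.toComplHom a) = ρ a := p.liftRingHom_toCompl ρ h a

end Pullback

end CStarSeminorm

/-- A `*`-homomorphism from a Banach `*`-algebra to a C⋆-algebra is contractive. -/
theorem norm_starAlgHom_le {B C : Type*} [NormedRing B] [NormedAlgebra ℂ B] [CompleteSpace B]
    [StarRing B] [NormedStarGroup B] [CStarAlgebra C] (ρ : B →⋆ₐ[ℂ] C) (a : B) :
    ‖ρ a‖ ≤ ‖a‖ := by
  have key : spectralRadius ℂ (star a * a) ≤ (‖star a * a‖₊ : ENNReal) := by
    refine le_of_tendsto (spectrum.pow_nnnorm_pow_one_div_tendsto_nhds_spectralRadius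
      (star a * a)) ((Filter.eventually_gt_atTop 0).mono fun n hn => ?_)
    calc ((‖(star a * a) ^ n‖₊ : ENNReal)) ^ (1 / n : ℝ)
        ≤ ((‖star a * a‖₊ : ENNReal) ^ n) ^ (1 / n : ℝ) := by
          refine ENNReal.rpow_le_rpow ?_ (by positivity)
          exact_mod_cast nnnorm_pow_le' (star a * a) hn
      _ = (‖star a * a‖₊ : ENNReal) := by
          rw [← ENNReal.rpow_natCast, ← ENNReal.rpow_mul, mul_one_div_cancel (by positivity),
            ENNReal.rpow_one]
  have h1 : (‖ρ (star a * a)‖₊ : ENNReal) ≤ ‖star a * a‖₊ := by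
    rw [← ((IsSelfAdjoint.star_mul_self a).map ρ).spectralRadius_eq_nnnorm]
    exact (iSup_le_iSup_of_subset (AlgHom.spectrum_apply_subset ρ (star a * a))).trans key
  have h2 : ‖ρ (star a * a)‖ ≤ ‖star a * a‖ := by exact_mod_cast h1
  rw [map_mul, map_star, CStarRing.norm_star_mul_self] at h2
  have h3 : ‖star a * a‖ ≤ ‖a‖ * ‖a‖ := (norm_mul_le _ _).trans_eq (by rw [norm_star])
  exact abs_le_of_sq_le_sq' (by nlinarith) (norm_nonneg _) |>.2

section Enveloping

variable (B : Type*) [NormedRing B] [NormedAlgebra ℂ B] [CompleteSpace B] [StarRing B]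
  [NormedStarGroup B] [StarModule ℂ B]

variable {B} in
theorem CStarSeminorm.le_norm (p : CStarSeminorm B) (a : B) : p.toSeminorm a ≤ ‖a‖ := by
  rw [← p.norm_toCompl a]; exact norm_starAlgHom_le (C := p.Compl) p.toComplHom a

variable {B} in
theorem bddAbove_cstarSeminorm (a : B) :
    BddAbove (Set.range fun p : CStarSeminorm B => p.toSeminorm a) :=
  ⟨‖a‖, by rintro _ ⟨p, rfl⟩; exact p.le_norm a⟩

/-- The largest C⋆-seminorm on a unital Banach `*`-algebra, `a ↦ sup_ρ ‖ρ a‖` with `ρ` running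
through the `*`-representations. It is expressed through the C⋆-seminorms, so that no universe has
to be fixed for the spaces of the representations. -/
def maxCStarSeminorm : CStarSeminorm B where
  __ := Seminorm.ofSMulLE (fun a : B => ⨆ p : CStarSeminorm B, p.toSeminorm a) (by simp)
    (fun a b => ciSup_le fun p => (map_add_le_add p.toSeminorm a b).trans
      (add_le_add (le_ciSup (bddAbove_cstarSeminorm a) p) (le_ciSup (bddAbove_cstarSeminorm b) p)))
    (fun c a => ciSup_le fun p => by
      rw [map_smul_eq_mul]
      exact mul_le_mul_of_nonneg_left (le_ciSup (bddAbove_cstarSeminorm a) p) (norm_nonneg c))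
  mul_le' a b := ciSup_le fun p => (p.mul_le a b).trans
      (mul_le_mul (le_ciSup (bddAbove_cstarSeminorm a) p) (le_ciSup (bddAbove_cstarSeminorm b) p)
        (apply_nonneg _ _) ((apply_nonneg p.toSeminorm a).trans
          (le_ciSup (bddAbove_cstarSeminorm a) p)))
  star_mul_self' a := by
    change (⨆ p : CStarSeminorm B, p.toSeminorm (star a * a)) =
      (⨆ p : CStarSeminorm B, p.toSeminorm a) ^ 2
    have h0 : 0 ≤ ⨆ p : CStarSeminorm B, p.toSeminorm a :=
      Real.iSup_nonneg fun p => apply_nonneg _ _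
    refine le_antisymm (ciSup_le fun p => ?_) ?_
    · rw [p.star_mul_self]
      exact pow_le_pow_left₀ (apply_nonneg _ _) (le_ciSup (bddAbove_cstarSeminorm a) p) 2
    · rw [← Real.le_sqrt h0 (Real.iSup_nonneg fun p => apply_nonneg _ _)]
      refine ciSup_le fun p => Real.le_sqrt_of_sq_le ?_
      rw [← p.star_mul_self]
      exact le_ciSup (bddAbove_cstarSeminorm (star a * a)) p

/-- The enveloping C⋆-algebra of a unital Banach `*`-algebra: the Hausdorff completion with respect
to the largest C⋆-seminorm. Every `*`-homomorphism to a C⋆-algebra extends to it. -/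
abbrev EnvelopingCStarAlgebra : Type _ := (maxCStarSeminorm B).Compl

variable {B}

/-- The canonical `*`-homomorphism to the enveloping C⋆-algebra. -/
def toEnveloping : B →⋆ₐ[ℂ] EnvelopingCStarAlgebra B := (maxCStarSeminorm B).toComplHom

/-- The extension of a representation to the enveloping C⋆-algebra. -/
def liftEnveloping {C : Type*} [CStarAlgebra C] (ρ : B →⋆ₐ[ℂ] C) :
    EnvelopingCStarAlgebra B →⋆ₐ[ℂ] C :=
  (maxCStarSeminorm B).lift ρ fun a => le_ciSup (bddAbove_cstarSeminorm a) (CStarSeminorm.ofHom ρ)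

theorem liftEnveloping_apply {C : Type*} [CStarAlgebra C] (ρ : B →⋆ₐ[ℂ] C) (a : B) :
    liftEnveloping ρ (toEnveloping a) = ρ a := CStarSeminorm.lift_apply _ _ _ _

end Enveloping


section Dynamics

/-- The positive cone `Γ⁺` of a totally ordered abelian group `Γ`. -/
abbrev PosCone (Γ : Type*) [Zero Γ] [LE Γ] : Type _ := {x : Γ // 0 ≤ x}

/-- The element of `Γ⁺` given by `g`, if `0 ≤ g` (and `0` otherwise). -/
def toCone {Γ : Type*} [Zero Γ] [LinearOrder Γ] (g : Γ) : PosCone Γ := ⟨max g 0, le_max_right _ _⟩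

/-- An action `α` of `Γ⁺` on the unital C⋆-algebra `A` by `*`-endomorphisms (which need not preserve
the unit). -/
structure EndAction (Γ A : Type*) [AddCommGroup Γ] [LinearOrder Γ] [IsOrderedAddMonoid Γ]
    [CStarAlgebra A] where
  toFun : PosCone Γ → (A →⋆ₙₐ[ℂ] A)
  map_zero' : ∀ a, toFun 0 a = a
  map_add' : ∀ x y a, toFun (x + y) a = toFun x (toFun y a)

instance {Γ A : Type*} [AddCommGroup Γ] [LinearOrder Γ] [IsOrderedAddMonoid Γ]
    [CStarAlgebra A] : CoeFun (EndAction Γ A) (fun _ => PosCone Γ → (A →⋆ₙₐ[ℂ] A)) :=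
  ⟨EndAction.toFun⟩

variable {Γ : Type u} {A : Type v} [AddCommGroup Γ] [LinearOrder Γ] [IsOrderedAddMonoid Γ]
  [CStarAlgebra A]

/-- `L` is a complete transfer action for `α`: an action of `Γ⁺` by continuous, linear, positive
maps with `L_x(α_x(a)b) = a L_x(b)` and `α_x(L_x(a)) = α_x(1) a α_x(1)`. -/
structure IsCompleteTransferAction (α : EndAction Γ A) (L : PosCone Γ → (A →L[ℂ] A)) : Prop where
  pos : ∀ x a, ∃ b, L x (star a * a) = star b * b
  add : ∀ x y a, L (x + y) a = L y (L x a)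
  transfer : ∀ x a b, L x (α x a * b) = a * L x b
  complete : ∀ x a, α x (L x a) = α x 1 * a * α x 1

/-- The system `(A, Γ⁺, α)` is finely representable. A unital `*`-homomorphism
`A →⋆ₐ[ℂ] (H →L[ℂ] H)` is the same as a non-degenerate representation of the unital algebra `A`. -/
def IsFinelyRepresentable (α : EndAction Γ A) : Prop :=
  ∃ (H : Type w) (_ : NormedAddCommGroup H) (_ : InnerProductSpace ℂ H) (_ : CompleteSpace H)
    (π : A →⋆ₐ[ℂ] (H →L[ℂ] H)) (U : PosCone Γ → (H →L[ℂ] H)),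
    Function.Injective π ∧
    (∀ x y, U (x + y) = U x * U y) ∧
    (∀ x a, π (α x a) = U x * π a * star (U x)) ∧
    (∀ x a, star (U x) * π a * U x ∈ Set.range π) ∧
    (∀ x a, U x * π a = π (α x a) * U x)

/-- Covariant representations `(π, U, H)` of `(A, Γ⁺, α)` with transfer action `L`: a non-degenerate
(that is, unital) representation `π` of `A` and a semigroup homomorphism `U` of `Γ⁺` on a Hilbert
space `H` with `U_x π(a) U_x^* = π(α_x(a))` and `U_x^* π(a) U_x = π(L_x(a))`. -/
structure CovariantRep (α : EndAction Γ A) (L : PosCone Γ → (A →L[ℂ] A))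
    (H : Type w') [NormedAddCommGroup H] [InnerProductSpace ℂ H] [CompleteSpace H] where
  π : A →⋆ₐ[ℂ] (H →L[ℂ] H)
  U : PosCone Γ → (H →L[ℂ] H)
  U_add : ∀ x y, U (x + y) = U x * U y
  conj : ∀ x a, U x * π a * star (U x) = π (α x a)
  conj_star : ∀ x a, star (U x) * π a * U x = π (L x a)

/-! ### Existence and uniqueness of the complete transfer action -/

namespace IsCompleteTransferAction

variable {α : EndAction Γ A} {L L' : PosCone Γ → (A →L[ℂ] A)}

theorem star_map (hL : IsCompleteTransferAction α L) (x : PosCone Γ) (a : A) :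
    L x (star a) = star (L x a) := by
  have sa (c : A) : star (L x (star c * c)) = L x (star c * c) := by
    obtain ⟨b, hb⟩ := hL.pos x c
    rw [hb, star_mul, star_star]
  have h0 := sa a
  have h1 := sa 1
  have h2 := sa (1 + a)
  have h3 := sa (1 + Complex.I • a)
  have e1 : star (1 : A) * 1 = 1 := by simp
  have e2 : star (1 + a) * (1 + a) = 1 + (star a + a) + star a * a := by
    rw [star_add, star_one]; noncomm_ring
  have e3 : star (1 + Complex.I • a) * (1 + Complex.I • a) =
      1 + Complex.I • (a - star a) + star a * a := by
    rw [star_add, star_one, star_smul, add_mul, mul_add, mul_add, smul_mul_smul_comm]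
    simp only [Complex.star_def, Complex.conj_I, neg_mul, Complex.I_mul_I, neg_neg, one_smul,
      neg_smul, one_mul, mul_one, smul_sub]
    abel
  rw [e1] at h1
  rw [e2] at h2
  rw [e3] at h3
  simp only [map_add, star_add, h0, h1, add_left_inj, add_right_inj, map_smul, map_sub,
    star_smul, star_sub, Complex.star_def, Complex.conj_I, neg_smul] at h2 h3
  rw [← smul_neg] at h3
  have h4 := smul_right_injective A Complex.I_ne_zero h3
  have h5 : star (L x (star a)) = L x a := by
    have h6 : (2 : ℂ) • star (L x (star a)) = (2 : ℂ) • L x a := by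
      rw [two_smul, two_smul]
      have h7 := congrArg₂ (· + ·) h2 h4
      beta_reduce at h7
      rw [← sub_eq_zero] at h7 ⊢
      rw [← h7]
      abel
    exact smul_right_injective A two_ne_zero h6
  rw [← h5, star_star]

theorem transfer_right (hL : IsCompleteTransferAction α L) (x : PosCone Γ) (a b : A) :
    L x (b * α x a) = L x b * a := by
  have h := hL.transfer x (star a) (star b)
  have h2 := congrArg star h
  rw [← hL.star_map, star_mul, star_mul, ← hL.star_map, star_star, star_star,
    ← map_star (α x), star_star] at h2
  exact h2

theorem unique (hL : IsCompleteTransferAction α L) (hL' : IsCompleteTransferAction α L') :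
    L = L' := by
  have one_left (M : PosCone Γ → (A →L[ℂ] A)) (hM : IsCompleteTransferAction α M) (x a) :
      M x (α x 1 * a * α x 1) = M x a := by
    rw [hM.transfer_right, hM.transfer, one_mul, mul_one]
  have key (M M' : PosCone Γ → (A →L[ℂ] A)) (hM : IsCompleteTransferAction α M)
      (hM' : IsCompleteTransferAction α M') (x a) : M x a = M' x a * M x 1 := by
    rw [← one_left M hM x a, ← hM'.complete, ← mul_one (α x (M' x a)), hM.transfer]
  have hsa (M : PosCone Γ → (A →L[ℂ] A)) (hM : IsCompleteTransferAction α M) (x) :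
      star (M x 1) = M x 1 := by rw [← hM.star_map, star_one]
  funext x
  ext a
  have h1 : L x 1 = L' x 1 := by
    have e1 := key L L' hL hL' x 1
    have e2 := key L' L hL' hL x 1
    rw [← hsa L hL x, e1, star_mul, hsa L hL, hsa L' hL', ← e2]
  rw [key L L' hL hL' x a, h1, ← key L' L' hL' hL' x a]

end IsCompleteTransferAction

theorem IsFinelyRepresentable.exists_transfer {α : EndAction Γ A}
    (h : IsFinelyRepresentable.{u, v, w} α) : ∃ L, IsCompleteTransferAction α L ∧
      ∃ (H : Type w) (_ : NormedAddCommGroup H) (_ : InnerProductSpace ℂ H) (_ : CompleteSpace H)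
        (ρ : CovariantRep α L H), Function.Injective ρ.π := by
  obtain ⟨H, i1, i2, i3, π, U, hinj, hadd, hconj, hran, hcomm⟩ := h
  choose M hM using hran
  have hnorm (a : A) : ‖π a‖ = ‖a‖ := NonUnitalStarAlgHom.norm_map π hinj a
  let Ml (x : PosCone Γ) : A →ₗ[ℂ] A :=
    { toFun := M x
      map_add' := fun a b => hinj (by rw [map_add, hM, hM, hM, map_add, mul_add, add_mul])
      map_smul' := fun c a => hinj (by
        rw [RingHom.id_apply, map_smul, hM, hM, map_smul, mul_smul_comm, smul_mul_assoc]) }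
  let L (x : PosCone Γ) : A →L[ℂ] A := (Ml x).mkContinuous (‖U x‖ * ‖U x‖) fun a => by
    change ‖M x a‖ ≤ _
    rw [← hnorm, hM, ← hnorm a]
    calc ‖star (U x) * π a * U x‖ ≤ ‖star (U x)‖ * ‖π a‖ * ‖U x‖ := norm_mul₃_le
      _ = ‖U x‖ * ‖U x‖ * ‖π a‖ := by rw [norm_star]; ring
  have hL (x a) : π (L x a) = star (U x) * π a * U x := hM x a
  have hcomm' (x a) : π a * star (U x) = star (U x) * π (α x a) := by
    have := congrArg star (hcomm x (star a))
    rwa [star_mul, star_mul, ← map_star, ← map_star, ← map_star, star_star] at this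
  refine ⟨L, ⟨fun x a => ?_, fun x y a => hinj ?_, fun x a b => hinj ?_, fun x a => hinj ?_⟩,
    H, i1, i2, i3, ⟨π, U, hadd, fun x a => (hconj x a).symm, fun x a => (hL x a).symm⟩, hinj⟩
  · let _ := CStarAlgebra.spectralOrder A
    have := CStarAlgebra.spectralOrderedRing A
    let _ := CStarAlgebra.spectralOrder (H →L[ℂ] H)
    have := CStarAlgebra.spectralOrderedRing (H →L[ℂ] H)
    have e : π (L x (star a * a)) = star (π a * U x) * (π a * U x) := by
      rw [hL, map_mul, map_star, star_mul]; simp only [mul_assoc]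
    have hsa : IsSelfAdjoint (L x (star a * a)) := hinj (by rw [map_star, e]; simp)
    have hp : 0 ≤ π (L x (star a * a)) := by rw [e]; exact star_mul_self_nonneg _
    refine CStarAlgebra.nonneg_iff_eq_star_mul_self.1 ?_
    rw [StarOrderedRing.nonneg_iff_spectrum_nonneg (R := ℝ) _ hsa]
    rw [← hsa.map_spectrum_real π hinj]
    exact (StarOrderedRing.nonneg_iff_spectrum_nonneg (R := ℝ) _ (hsa.map π)).1 hp
  · rw [hL, hL, hL, hadd, star_mul]; simp only [mul_assoc]
  · rw [hL, map_mul, map_mul, hL, ← mul_assoc (star (U x)), ← hcomm']; simp only [mul_assoc]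
  · rw [hconj, hL, map_mul, map_mul, hconj, map_one]; simp only [mul_assoc, mul_one]

theorem IsFinelyRepresentable.existsUnique_transfer {α : EndAction Γ A}
    (h : IsFinelyRepresentable.{u, v, w} α) : ∃! L, IsCompleteTransferAction α L := by
  obtain ⟨L, hL, -⟩ := h.exists_transfer
  exact ⟨L, hL, fun L' hL' => hL'.unique hL⟩

/-- The unique complete transfer action of a finely representable system. -/
def IsFinelyRepresentable.transfer {α : EndAction Γ A}
    (h : IsFinelyRepresentable.{u, v, w} α) : PosCone Γ → (A →L[ℂ] A) :=
  h.existsUnique_transfer.choose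

theorem IsFinelyRepresentable.transfer_spec {α : EndAction Γ A}
    (h : IsFinelyRepresentable.{u, v, w} α) : IsCompleteTransferAction α h.transfer :=
  h.existsUnique_transfer.choose_spec.1

theorem IsFinelyRepresentable.exists_faithful {α : EndAction Γ A}
    (h : IsFinelyRepresentable.{u, v, w} α) :
    ∃ (H : Type w) (_ : NormedAddCommGroup H) (_ : InnerProductSpace ℂ H) (_ : CompleteSpace H)
      (ρ : CovariantRep α h.transfer H), Function.Injective ρ.π := by
  obtain ⟨L, hL, h'⟩ := h.exists_transfer
  rwa [hL.unique h.transfer_spec] at h'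

/-! ### The coefficient spaces and products of monomials -/

/-- `a` can be a coefficient at `g`: `a ∈ A α_g(1)` if `0 ≤ g`, and `a ∈ α_{-g}(1) A` if
`g ≤ 0`. -/
def IsCoeff (α : EndAction Γ A) (g : Γ) (a : A) : Prop :=
  (0 ≤ g → ∃ b, a = b * α (toCone g) 1) ∧ (g ≤ 0 → ∃ b, a = α (toCone (-g)) 1 * b)

/-- The coefficient at `g₁ + g₂` of the product of the monomials `aδ_{g₁}` and `bδ_{g₂}`, with the
cases `g₁ > 0 > g₂`, then `g₁ < 0 < g₂`, then `g₁, g₂ ≥ 0` or `g₁, g₂ ≤ 0`. -/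
def monomialMul (α : EndAction Γ A) (L : PosCone Γ → (A →L[ℂ] A)) (g₁ g₂ : Γ) (a b : A) : A :=
  if 0 < g₁ ∧ g₂ < 0 then
    if 0 ≤ g₁ + g₂ then a * α (toCone (g₁ + g₂)) b else α (toCone (-(g₁ + g₂))) a * b
  else if g₁ < 0 ∧ 0 < g₂ then
    if 0 ≤ g₁ + g₂ then L (toCone (-g₁)) (a * b) else L (toCone g₂) (a * b)
  else
    if 0 ≤ g₁ + g₂ then a * α (toCone g₁) b else α (toCone (-g₂)) a * b

theorem toCone_add {g h : Γ} (hg : 0 ≤ g) (hh : 0 ≤ h) :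
    toCone (g + h) = toCone g + toCone h :=
  Subtype.ext (by simp [toCone, hg, hh, add_nonneg hg hh])

theorem toCone_zero {Γ : Type*} [Zero Γ] [LinearOrder Γ] : toCone (0 : Γ) = 0 := Subtype.ext (by simp [toCone])

theorem EndAction.one_mul_one (α : EndAction Γ A) (x : PosCone Γ) : α x 1 * α x 1 = α x 1 := by
  rw [← map_mul, one_mul]

theorem EndAction.star_one (α : EndAction Γ A) (x : PosCone Γ) : star (α x 1) = α x 1 := by
  rw [← map_star, _root_.star_one]

theorem isCoeff_iff (α : EndAction Γ A) (g : Γ) (a : A) :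
    IsCoeff α g a ↔ (0 ≤ g → a * α (toCone g) 1 = a) ∧ (g ≤ 0 → α (toCone (-g)) 1 * a = a) := by
  refine and_congr (imp_congr_right fun _ => ⟨?_, fun h => ⟨a, h.symm⟩⟩)
    (imp_congr_right fun _ => ⟨?_, fun h => ⟨a, h.symm⟩⟩)
  · rintro ⟨b, rfl⟩; rw [mul_assoc, α.one_mul_one]
  · rintro ⟨b, rfl⟩; rw [← mul_assoc, α.one_mul_one]

theorem isCoeff_of_nonneg {α : EndAction Γ A} {g : Γ} (hg : 0 ≤ g) {a : A}
    (h : a * α (toCone g) 1 = a) : IsCoeff α g a := by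
  rw [isCoeff_iff]
  refine ⟨fun _ => h, fun hg' => ?_⟩
  rw [le_antisymm hg' hg, neg_zero, toCone_zero, α.map_zero', one_mul]

theorem isCoeff_of_nonpos {α : EndAction Γ A} {g : Γ} (hg : g ≤ 0) {a : A}
    (h : α (toCone (-g)) 1 * a = a) : IsCoeff α g a := by
  rw [isCoeff_iff]
  refine ⟨fun hg' => ?_, fun _ => h⟩
  rw [le_antisymm hg hg', toCone_zero, α.map_zero', mul_one]

theorem IsCoeff.right {α : EndAction Γ A} {g : Γ} {a : A} (h : IsCoeff α g a) (hg : 0 ≤ g) :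
    a * α (toCone g) 1 = a := ((isCoeff_iff α g a).1 h).1 hg

theorem IsCoeff.left {α : EndAction Γ A} {g : Γ} {a : A} (h : IsCoeff α g a) (hg : g ≤ 0) :
    α (toCone (-g)) 1 * a = a := ((isCoeff_iff α g a).1 h).2 hg

theorem IsCoeff.star {α : EndAction Γ A} {g : Γ} {a : A} (h : IsCoeff α g a) :
    IsCoeff α (-g) (star a) := by
  rw [isCoeff_iff] at h ⊢
  refine ⟨fun hg => ?_, fun hg => ?_⟩
  · rw [← α.star_one, ← star_mul, h.2 (neg_nonneg.1 hg)]
  · rw [← α.star_one, ← star_mul, neg_neg, h.1 (neg_nonpos.1 hg)]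

theorem isCoeff_zero (α : EndAction Γ A) (a : A) : IsCoeff α 0 a :=
  isCoeff_of_nonneg le_rfl (by rw [toCone_zero, α.map_zero', mul_one])

theorem toCone_coe {Γ : Type*} [Zero Γ] [LinearOrder Γ] (x : PosCone Γ) : toCone (x : Γ) = x := Subtype.ext (max_eq_left x.2)

theorem isCoeff_cone (α : EndAction Γ A) (x : PosCone Γ) : IsCoeff α (x : Γ) (α x 1) :=
  isCoeff_of_nonneg x.2 (by rw [toCone_coe, α.one_mul_one])

theorem nonneg_of_not_mixed {g₁ g₂ : Γ} (h1 : ¬(0 < g₁ ∧ g₂ < 0)) (h3 : ¬(g₁ < 0 ∧ 0 < g₂))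
    (h2 : 0 ≤ g₁ + g₂) : 0 ≤ g₁ ∧ 0 ≤ g₂ := by
  by_contra h
  rcases not_and_or.1 h with h | h <;> rw [not_le] at h
  · exact h3 ⟨h, by by_contra h'; exact (add_neg_of_neg_of_nonpos h (not_lt.1 h')).not_ge h2⟩
  · exact h1 ⟨by by_contra h'; exact (add_neg_of_nonpos_of_neg (not_lt.1 h') h).not_ge h2, h⟩

theorem nonpos_of_not_mixed {g₁ g₂ : Γ} (h1 : ¬(0 < g₁ ∧ g₂ < 0)) (h3 : ¬(g₁ < 0 ∧ 0 < g₂))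
    (h2 : ¬0 ≤ g₁ + g₂) : g₁ ≤ 0 ∧ g₂ ≤ 0 := by
  by_contra h
  rcases not_and_or.1 h with h | h <;> rw [not_le] at h
  · exact h1 ⟨h, by by_contra h'; exact h2 (add_nonneg h.le (not_lt.1 h'))⟩
  · exact h3 ⟨by by_contra h'; exact h2 (add_nonneg (not_lt.1 h') h.le), h⟩

theorem isCoeff_monomialMul {α : EndAction Γ A} {L : PosCone Γ → (A →L[ℂ] A)}
    (hL : IsCompleteTransferAction α L) {g₁ g₂ : Γ} {a b : A} (ha : IsCoeff α g₁ a)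
    (hb : IsCoeff α g₂ b) : IsCoeff α (g₁ + g₂) (monomialMul α L g₁ g₂ a b) := by
  unfold monomialMul
  split_ifs with h1 h2 h3 h2 h2
  · refine isCoeff_of_nonneg h2 ?_
    rw [mul_assoc, ← map_mul, mul_one]
  · refine isCoeff_of_nonpos (not_le.1 h2).le ?_
    rw [← mul_assoc, ← map_mul, one_mul]
  · refine isCoeff_of_nonneg h2 ?_
    have e : g₂ = -g₁ + (g₁ + g₂) := by abel
    rw [← hL.transfer_right, mul_assoc, ← α.map_add', ← toCone_add (by simpa using h3.1.le) h2,
      ← e, hb.right h3.2.le]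
  · refine isCoeff_of_nonpos (not_le.1 h2).le ?_
    have e : -g₁ = g₂ + -(g₁ + g₂) := by abel
    rw [← hL.transfer, ← mul_assoc, ← α.map_add', ← toCone_add h3.2.le
      (neg_nonneg.2 (not_le.1 h2).le), ← e, ha.left h3.1.le]
  · have h5 := nonneg_of_not_mixed h1 h3 h2
    refine isCoeff_of_nonneg h2 ?_
    rw [toCone_add h5.1 h5.2, α.map_add', mul_assoc, ← map_mul, hb.right h5.2]
  · have h5 := nonpos_of_not_mixed h1 h3 h2
    refine isCoeff_of_nonpos (not_le.1 h2).le ?_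
    rw [neg_add_rev, toCone_add (neg_nonneg.2 h5.2) (neg_nonneg.2 h5.1), α.map_add', ← mul_assoc,
      ← map_mul, ha.left h5.1]

/-! ### Monomials in a covariant representation -/

namespace CovariantRep

variable {α : EndAction Γ A} {L : PosCone Γ → (A →L[ℂ] A)}
  {H : Type w'} [NormedAddCommGroup H] [InnerProductSpace ℂ H] [CompleteSpace H]

theorem U_zero (ρ : CovariantRep α L H) : ρ.U 0 = 1 := by
  have h1 := ρ.conj 0 1
  rw [α.map_zero', map_one, mul_one] at h1
  have h2 := ρ.U_add 0 0
  rw [add_zero] at h2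
  calc ρ.U 0 = ρ.U 0 * (ρ.U 0 * star (ρ.U 0)) := by rw [h1, mul_one]
    _ = ρ.U 0 * star (ρ.U 0) := by rw [← mul_assoc, ← h2]
    _ = 1 := h1

theorem U_mul_star (ρ : CovariantRep α L H) (x : PosCone Γ) :
    ρ.U x * star (ρ.U x) = ρ.π (α x 1) := by
  rw [← ρ.conj, map_one, mul_one]

theorem comm (ρ : CovariantRep α L H) (x : PosCone Γ) (a : A) :
    ρ.U x * ρ.π a = ρ.π (α x a) * ρ.U x := by
  rw [← sub_eq_zero, ← CStarRing.mul_star_self_eq_zero_iff]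
  have e : star (ρ.U x * ρ.π a - ρ.π (α x a) * ρ.U x) =
      ρ.π (star a) * star (ρ.U x) - star (ρ.U x) * ρ.π (α x (star a)) := by
    rw [star_sub, star_mul, star_mul, map_star, map_star, map_star]
  rw [e, sub_mul, mul_sub, mul_sub]
  have t1 : ρ.U x * ρ.π a * (ρ.π (star a) * star (ρ.U x)) = ρ.π (α x (a * star a)) := by
    rw [← ρ.conj, map_mul]; simp only [mul_assoc]
  have t2 : ρ.U x * ρ.π a * (star (ρ.U x) * ρ.π (α x (star a))) = ρ.π (α x (a * star a)) := by
    rw [map_mul (α x), map_mul, ← ρ.conj x a]; simp only [mul_assoc]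
  have t3 : ρ.π (α x a) * ρ.U x * (ρ.π (star a) * star (ρ.U x)) = ρ.π (α x (a * star a)) := by
    rw [map_mul (α x), map_mul, ← ρ.conj x (star a)]; simp only [mul_assoc]
  have t4 : ρ.π (α x a) * ρ.U x * (star (ρ.U x) * ρ.π (α x (star a))) =
      ρ.π (α x (a * star a)) := by
    have : a * star a = a * 1 * star a := by rw [mul_one]
    rw [this, map_mul (α x), map_mul (α x), map_mul, map_mul, ← ρ.U_mul_star]
    simp only [mul_assoc]
  rw [t1, t2, t3, t4, sub_self]

theorem comm_star (ρ : CovariantRep α L H) (x : PosCone Γ) (a : A) :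
    ρ.π a * star (ρ.U x) = star (ρ.U x) * ρ.π (α x a) := by
  have := congrArg star (ρ.comm x (star a))
  rwa [star_mul, star_mul, ← map_star, ← map_star, ← map_star, star_star] at this

theorem norm_U_le (ρ : CovariantRep α L H) (x : PosCone Γ) : ‖ρ.U x‖ ≤ 1 := by
  have h1 : ‖ρ.U x‖ * ‖ρ.U x‖ ≤ ‖α x 1‖ := by
    rw [← CStarRing.norm_self_mul_star, ρ.U_mul_star]
    exact NonUnitalStarAlgHom.norm_apply_le ρ.π _
  have h2 : ‖α x 1‖ * ‖α x 1‖ = ‖α x 1‖ := by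
    rw [← CStarRing.norm_self_mul_star, α.star_one, α.one_mul_one]
  have h3 : ‖α x 1‖ ≤ 1 := by nlinarith [norm_nonneg (α x 1)]
  nlinarith [norm_nonneg (ρ.U x)]

/-- The operator representing `aδ_g`: `π(a)U_g` if `0 ≤ g`, and `U_{-g}^* π(a)` if `g < 0`. -/
def monomial (ρ : CovariantRep α L H) (g : Γ) (a : A) : H →L[ℂ] H :=
  if 0 ≤ g then ρ.π a * ρ.U (toCone g) else star (ρ.U (toCone (-g))) * ρ.π a

theorem monomial_nonneg (ρ : CovariantRep α L H) {g : Γ} (hg : 0 ≤ g) (a : A) :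
    ρ.monomial g a = ρ.π a * ρ.U (toCone g) := if_pos hg

theorem monomial_nonpos (ρ : CovariantRep α L H) {g : Γ} (hg : g ≤ 0) (a : A) :
    ρ.monomial g a = star (ρ.U (toCone (-g))) * ρ.π a := by
  rcases hg.eq_or_lt with rfl | h
  · rw [ρ.monomial_nonneg le_rfl, neg_zero, toCone_zero, U_zero, star_one, mul_one, one_mul]
  · exact if_neg (not_le.2 h)

theorem monomial_zero (ρ : CovariantRep α L H) (a : A) : ρ.monomial 0 a = ρ.π a := by
  rw [ρ.monomial_nonneg le_rfl, toCone_zero, U_zero, mul_one]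

theorem monomial_add (ρ : CovariantRep α L H) (g : Γ) (a b : A) :
    ρ.monomial g (a + b) = ρ.monomial g a + ρ.monomial g b := by
  unfold monomial; split_ifs <;> simp [add_mul, mul_add]

theorem monomial_smul (ρ : CovariantRep α L H) (g : Γ) (c : ℂ) (a : A) :
    ρ.monomial g (c • a) = c • ρ.monomial g a := by
  unfold monomial; split_ifs <;> simp

theorem monomial_star (ρ : CovariantRep α L H) (g : Γ) (a : A) :
    ρ.monomial (-g) (star a) = star (ρ.monomial g a) := by
  rcases le_total 0 g with h | h
  · rw [ρ.monomial_nonneg h, ρ.monomial_nonpos (neg_nonpos.2 h), star_mul, map_star, neg_neg]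
  · rw [ρ.monomial_nonpos h, ρ.monomial_nonneg (neg_nonneg.2 h), star_mul, map_star, star_star]

theorem norm_monomial_le (ρ : CovariantRep α L H) (g : Γ) (a : A) :
    ‖ρ.monomial g a‖ ≤ ‖a‖ := by
  have h1 : ‖ρ.π a‖ ≤ ‖a‖ := NonUnitalStarAlgHom.norm_apply_le ρ.π a
  unfold monomial
  split_ifs
  · calc _ ≤ ‖ρ.π a‖ * ‖ρ.U (toCone g)‖ := norm_mul_le _ _
      _ ≤ ‖a‖ * 1 := by gcongr; exact ρ.norm_U_le _
      _ = ‖a‖ := mul_one _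
  · calc _ ≤ ‖star (ρ.U (toCone (-g)))‖ * ‖ρ.π a‖ := norm_mul_le _ _
      _ ≤ 1 * ‖a‖ := by gcongr; rw [norm_star]; exact ρ.norm_U_le _
      _ = ‖a‖ := one_mul _

theorem norm_monomial (ρ : CovariantRep α L H) (hρ : Function.Injective ρ.π) {g : Γ} {a : A}
    (ha : IsCoeff α g a) : ‖ρ.monomial g a‖ = ‖a‖ := by
  have hnorm (a : A) : ‖ρ.π a‖ = ‖a‖ := NonUnitalStarAlgHom.norm_map ρ.π hρ a
  have key {h : Γ} (hh : 0 ≤ h) {b : A} (hb : IsCoeff α h b) : ‖ρ.monomial h b‖ = ‖b‖ := by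
    have e : ‖ρ.monomial h b‖ * ‖ρ.monomial h b‖ = ‖b‖ * ‖b‖ := by
      rw [← CStarRing.norm_self_mul_star, ρ.monomial_nonneg hh, star_mul, mul_assoc,
        ← mul_assoc (ρ.U _), U_mul_star, ← mul_assoc, ← map_mul, hb.right hh, ← map_star,
        ← map_mul, hnorm, CStarRing.norm_self_mul_star]
    exact (mul_self_inj (norm_nonneg _) (norm_nonneg _)).1 e
  rcases le_total 0 g with h | h
  · exact key h ha
  · have := key (neg_nonneg.2 h) ha.star
    rwa [monomial_star, norm_star, norm_star] at this

theorem monomial_mul (ρ : CovariantRep α L H) {g₁ g₂ : Γ} {a b : A} (ha : IsCoeff α g₁ a)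
    (hb : IsCoeff α g₂ b) :
    ρ.monomial (g₁ + g₂) (monomialMul α L g₁ g₂ a b) = ρ.monomial g₁ a * ρ.monomial g₂ b := by
  have swap (y z : PosCone Γ) : ρ.U (y + z) = ρ.U z * ρ.U y := by rw [add_comm, ρ.U_add]
  unfold monomialMul
  split_ifs with h1 h2 h3 h2 h2
  · have e : g₁ = (g₁ + g₂) + -g₂ := by abel
    have e' : toCone g₁ = toCone (g₁ + g₂) + toCone (-g₂) := by
      rw [← toCone_add h2 (neg_nonneg.2 h1.2.le), ← e]
    rw [ρ.monomial_nonneg h2, ρ.monomial_nonneg h1.1.le, ρ.monomial_nonpos h1.2.le]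
    calc ρ.π (a * α (toCone (g₁ + g₂)) b) * ρ.U (toCone (g₁ + g₂))
        = ρ.π a * (ρ.U (toCone (g₁ + g₂)) * ρ.π b) := by
          rw [map_mul, mul_assoc, ← ρ.comm]
      _ = ρ.π a * (ρ.U (toCone (g₁ + g₂)) * ρ.π (α (toCone (-g₂)) 1 * b)) := by
          rw [hb.left h1.2.le]
      _ = ρ.π a * (ρ.U (toCone (g₁ + g₂)) *
            (ρ.U (toCone (-g₂)) * star (ρ.U (toCone (-g₂))) * ρ.π b)) := by
          rw [U_mul_star, map_mul]
      _ = _ := by rw [e', ρ.U_add]; simp only [mul_assoc]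
  · have h2' := (not_le.1 h2).le
    have e : -g₂ = g₁ + -(g₁ + g₂) := by abel
    have e' : toCone (-g₂) = toCone g₁ + toCone (-(g₁ + g₂)) := by
      rw [← toCone_add h1.1.le (neg_nonneg.2 h2'), ← e]
    rw [ρ.monomial_nonpos h2', ρ.monomial_nonneg h1.1.le, ρ.monomial_nonpos h1.2.le]
    calc star (ρ.U (toCone (-(g₁ + g₂)))) * ρ.π (α (toCone (-(g₁ + g₂))) a * b)
        = ρ.π (a * α (toCone g₁) 1) * star (ρ.U (toCone (-(g₁ + g₂)))) * ρ.π b := by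
          rw [map_mul, ← mul_assoc, ← ρ.comm_star, ha.right h1.1.le]
      _ = _ := by rw [map_mul, ← U_mul_star, e', swap, star_mul]; simp only [mul_assoc]
  · have e : g₂ = -g₁ + (g₁ + g₂) := by abel
    have e' : toCone g₂ = toCone (-g₁) + toCone (g₁ + g₂) := by
      rw [← toCone_add (neg_nonneg.2 h3.1.le) h2, ← e]
    rw [ρ.monomial_nonneg h2, ρ.monomial_nonpos h3.1.le, ρ.monomial_nonneg h3.2.le, ← ρ.conj_star,
      map_mul, e', ρ.U_add]
    simp only [mul_assoc]
  · have h2' := (not_le.1 h2).le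
    have e : -g₁ = g₂ + -(g₁ + g₂) := by abel
    have e' : toCone (-g₁) = toCone g₂ + toCone (-(g₁ + g₂)) := by
      rw [← toCone_add h3.2.le (neg_nonneg.2 h2'), ← e]
    rw [ρ.monomial_nonpos h2', ρ.monomial_nonpos h3.1.le, ρ.monomial_nonneg h3.2.le,
      ← ρ.conj_star, map_mul, e', ρ.U_add, star_mul]
    simp only [mul_assoc]
  · obtain ⟨p, q⟩ := nonneg_of_not_mixed h1 h3 h2
    rw [ρ.monomial_nonneg h2, ρ.monomial_nonneg p, ρ.monomial_nonneg q, map_mul, toCone_add p q,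
      ρ.U_add, mul_assoc, ← mul_assoc (ρ.π (α _ b)), ← ρ.comm]
    simp only [mul_assoc]
  · have h2' := (not_le.1 h2).le
    obtain ⟨p, q⟩ := nonpos_of_not_mixed h1 h3 h2
    rw [ρ.monomial_nonpos h2', ρ.monomial_nonpos p, ρ.monomial_nonpos q, map_mul, neg_add,
      toCone_add (neg_nonneg.2 p) (neg_nonneg.2 q), swap, star_mul, mul_assoc,
      ← mul_assoc (star (ρ.U (toCone (-g₂)))), ← ρ.comm_star]
    simp only [mul_assoc]

end CovariantRep

/-! ### Convolution of absolutely summable families -/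

section Convolution

variable {R : Type*} [NormedRing R]

theorem summable_conv_prod {G : Type*} [AddCommGroup G] {f f' : G → R}
    (hf : Summable fun g => ‖f g‖) (hf' : Summable fun g => ‖f' g‖) :
    Summable fun p : G × G => ‖f p.2‖ * ‖f' (p.1 - p.2)‖ := by
  have h := hf.mul_of_nonneg hf' (fun _ => norm_nonneg _) (fun _ => norm_nonneg _)
  refine h.comp_injective (i := fun p : G × G => (p.2, p.1 - p.2)) ?_
  rintro ⟨a, b⟩ ⟨c, d⟩ hh
  simp only [Prod.mk.injEq] at hh
  obtain ⟨rfl, h2⟩ := hh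
  rw [sub_left_inj.1 h2]

theorem tsum_conv [CompleteSpace R] {G : Type*} [AddCommGroup G] {f f' : G → R}
    (hf : Summable fun g => ‖f g‖) (hf' : Summable fun g => ‖f' g‖) :
    ∑' g, ∑' h, f h * f' (g - h) = (∑' g, f g) * ∑' g, f' g := by
  let e : G × G ≃ G × G :=
    { toFun := fun p => (p.2, p.1 - p.2), invFun := fun p => (p.1 + p.2, p.1)
      left_inv := fun p => by simp
      right_inv := fun p => by simp }
  have hs : Summable fun p : G × G => f p.2 * f' (p.1 - p.2) :=
    .of_norm_bounded (summable_conv_prod hf hf') fun p => norm_mul_le _ _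
  rw [tsum_mul_tsum_of_summable_norm hf hf', ← e.tsum_eq, ← hs.tsum_prod]
  rfl

theorem summable_norm_conv {G : Type*} [AddCommGroup G] {f f' : G → R}
    (hf : Summable fun g => ‖f g‖) (hf' : Summable fun g => ‖f' g‖) :
    Summable fun g => ∑' h, ‖f h‖ * ‖f' (g - h)‖ :=
  (summable_conv_prod hf hf').prod

theorem conv_assoc [CompleteSpace R] {G : Type*} [AddCommGroup G] {f₁ f₂ f₃ : G → R}
    (h₁ : Summable fun g => ‖f₁ g‖) (h₂ : Summable fun g => ‖f₂ g‖)
    (h₃ : Summable fun g => ‖f₃ g‖) (g : G) :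
    ∑' h, (∑' k, f₁ k * f₂ (h - k)) * f₃ (g - h) =
      ∑' k, f₁ k * ∑' m, f₂ m * f₃ (g - k - m) := by
  have hs12 := summable_conv_prod h₁ h₂
  have hb (x : G) : ‖f₃ x‖ ≤ ∑' g, ‖f₃ g‖ := h₃.le_tsum x fun _ _ => norm_nonneg _
  have hs : Summable fun p : G × G => f₁ p.2 * f₂ (p.1 - p.2) * f₃ (g - p.1) := by
    refine .of_norm_bounded (hs12.mul_right (∑' g, ‖f₃ g‖)) fun p => norm_mul₃_le.trans ?_
    exact mul_le_mul_of_nonneg_left (hb _) (by positivity)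
  have e1 (h : G) : (∑' k, f₁ k * f₂ (h - k)) * f₃ (g - h) =
      ∑' k, f₁ k * f₂ (h - k) * f₃ (g - h) := by
    have hs1 : Summable fun k => f₁ k * f₂ (h - k) :=
      .of_norm_bounded (hs12.prod_factor h) fun p => norm_mul_le _ _
    exact (hs1.tsum_mul_right _).symm
  have e2 (k : G) : f₁ k * ∑' m, f₂ m * f₃ (g - k - m) =
      ∑' h, f₁ k * f₂ (h - k) * f₃ (g - h) := by
    have hs2 : Summable fun m => f₂ m * f₃ (g - k - m) :=
      .of_norm_bounded (h₂.mul_right (∑' g, ‖f₃ g‖)) fun m => (norm_mul_le _ _).trans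
        (mul_le_mul_of_nonneg_left (hb _) (norm_nonneg _))
    rw [← hs2.tsum_mul_left, ← (Equiv.subRight k).tsum_eq]
    refine tsum_congr fun h => ?_
    rw [Equiv.subRight_apply, mul_assoc, sub_sub, add_sub_cancel]
  rw [tsum_congr e1, tsum_congr e2]
  exact (Summable.tsum_comm (f := fun h k => f₁ k * f₂ (h - k) * f₃ (g - h)) hs).symm

end Convolution

/-! ### The Banach `*`-algebra `ℓ¹(Γ, α, A)` -/

theorem IsCoeff.add {α : EndAction Γ A} {g : Γ} {a b : A} (ha : IsCoeff α g a)
    (hb : IsCoeff α g b) : IsCoeff α g (a + b) := by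
  rw [isCoeff_iff] at *
  exact ⟨fun h => by rw [add_mul, ha.1 h, hb.1 h], fun h => by rw [mul_add, ha.2 h, hb.2 h]⟩

theorem IsCoeff.smul {α : EndAction Γ A} {g : Γ} {a : A} (ha : IsCoeff α g a) (c : ℂ) :
    IsCoeff α g (c • a) := by
  rw [isCoeff_iff] at *
  exact ⟨fun h => by rw [smul_mul_assoc, ha.1 h], fun h => by rw [mul_smul_comm, ha.2 h]⟩

theorem IsCoeff.zero (α : EndAction Γ A) (g : Γ) : IsCoeff α g (0 : A) :=
  (isCoeff_iff α g 0).2 ⟨fun _ => zero_mul _, fun _ => mul_zero _⟩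

theorem IsCoeff.tsum {α : EndAction Γ A} {g : Γ} {ι : Type*} {t : ι → A} (ht : Summable t)
    (h : ∀ i, IsCoeff α g (t i)) : IsCoeff α g (∑' i, t i) := by
  rw [isCoeff_iff]
  refine ⟨fun hg => ?_, fun hg => ?_⟩
  · rw [← ht.tsum_mul_right]; exact tsum_congr fun i => (h i).right hg
  · rw [← ht.tsum_mul_left]; exact tsum_congr fun i => (h i).left hg

/-- The absolutely summable families `a : Γ → A` with `a_x ∈ A α_x(1)` and `a_{-x} ∈ α_x(1) A` for
all `x ∈ Γ⁺`. -/
def l1Submodule (α : EndAction Γ A) : Submodule ℂ (lp (fun _ : Γ => A) 1) where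
  carrier := {a | ∀ g, IsCoeff α g (a g)}
  add_mem' ha hb g := (ha g).add (hb g)
  zero_mem' g := IsCoeff.zero α g
  smul_mem' c _ ha g := (ha g).smul c

theorem isClosed_l1Submodule (α : EndAction Γ A) :
    IsClosed (l1Submodule α : Set (lp (fun _ : Γ => A) 1)) := by
  have hc (g : Γ) : Continuous fun a : lp (fun _ : Γ => A) 1 => a g :=
    (continuous_apply g).comp lp.uniformContinuous_coe.continuous
  have e : (l1Submodule α : Set (lp (fun _ : Γ => A) 1)) =
      ⋂ g, {a | (0 ≤ g → a g * α (toCone g) 1 = a g) ∧ (g ≤ 0 → α (toCone (-g)) 1 * a g = a g)} := by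
    ext a
    simp only [Set.mem_iInter, Set.mem_ofPred_eq, ← isCoeff_iff]
    rfl
  rw [e]
  refine isClosed_iInter fun g => IsClosed.and ?_ ?_
  · by_cases hg : 0 ≤ g
    · simp only [hg, true_imp_iff]; exact isClosed_eq ((hc g).mul continuous_const) (hc g)
    · simp only [hg, false_imp_iff]; exact isClosed_univ
  · by_cases hg : g ≤ 0
    · simp only [hg, true_imp_iff]; exact isClosed_eq (continuous_const.mul (hc g)) (hc g)
    · simp only [hg, false_imp_iff]; exact isClosed_univ

/-- The underlying space of the Banach `*`-algebra `ℓ¹(Γ, α, A)` of a finely representable system.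
Its norm is `‖a‖ = ∑ ‖a_g‖`. -/
def L1 (α : EndAction Γ A) (_ : IsFinelyRepresentable.{u, v, w} α) : Type (max u v) :=
  l1Submodule α

namespace L1

variable {α : EndAction Γ A} {hα : IsFinelyRepresentable.{u, v, w} α}

instance instNormedAddCommGroup : NormedAddCommGroup (L1 α hα) :=
  inferInstanceAs (NormedAddCommGroup (l1Submodule α))
instance instNormedSpace : NormedSpace ℂ (L1 α hα) :=
  inferInstanceAs (NormedSpace ℂ (l1Submodule α))
instance instCompleteSpace : CompleteSpace (L1 α hα) :=
  (isClosed_l1Submodule α).completeSpace_coe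

instance : CoeFun (L1 α hα) fun _ => Γ → A := ⟨fun a => a.1⟩

theorem isCoeff (a : L1 α hα) (g : Γ) : IsCoeff α g (a g) := a.2 g

theorem ext {a b : L1 α hα} (h : ∀ g, a g = b g) : a = b := Subtype.ext (lp.ext (funext h))

theorem add_apply (a b : L1 α hα) (g : Γ) : (a + b) g = a g + b g := rfl

theorem smul_apply (c : ℂ) (a : L1 α hα) (g : Γ) : (c • a) g = c • a g := rfl

theorem zero_apply (g : Γ) : (0 : L1 α hα) g = 0 := rfl

theorem hasSum_norm (a : L1 α hα) : HasSum (fun g => ‖a g‖) ‖a‖ := by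
  have := lp.hasSum_norm (p := 1) (by simp) a.1
  simp only [ENNReal.toReal_one, Real.rpow_one] at this
  exact this

theorem summable_norm (a : L1 α hα) : Summable fun g => ‖a g‖ := a.hasSum_norm.summable

/-- The element of `ℓ¹(Γ, α, A)` with the given coefficients. -/
def mk (f : Γ → A) (hf : Summable fun g => ‖f g‖) (hc : ∀ g, IsCoeff α g (f g)) : L1 α hα :=
  ⟨⟨f, (memℓp_gen_iff (p := 1) (by simp)).2 (by simpa using hf)⟩, hc⟩

/-- The monomial `aδ_g`. -/
def single (g : Γ) (a : A) (ha : IsCoeff α g a) : L1 α hα :=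
  mk (fun h => if h = g then a else 0)
    (summable_of_ne_finset_zero (s := {g}) fun h hh => by simp [Finset.notMem_singleton.1 hh])
    fun h => by
      split_ifs with e
      · rw [e]; exact ha
      · exact IsCoeff.zero α h

theorem single_apply (g : Γ) (a : A) (ha : IsCoeff α g a) (h : Γ) :
    (single g a ha : L1 α hα) h = if h = g then a else 0 := rfl

theorem norm_monomialMul_le (hα : IsFinelyRepresentable.{u, v, w} α) {g₁ g₂ : Γ} {a b : A}
    (ha : IsCoeff α g₁ a) (hb : IsCoeff α g₂ b) :
    ‖monomialMul α hα.transfer g₁ g₂ a b‖ ≤ ‖a‖ * ‖b‖ := by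
  obtain ⟨H, _, _, _, ρ, hρ⟩ := hα.exists_faithful
  rw [← ρ.norm_monomial hρ (isCoeff_monomialMul hα.transfer_spec ha hb), ρ.monomial_mul ha hb]
  exact (norm_mul_le _ _).trans
    (mul_le_mul (ρ.norm_monomial_le _ _) (ρ.norm_monomial_le _ _) (norm_nonneg _) (norm_nonneg _))

theorem norm_mul_term_le (a b : L1 α hα) (g h : Γ) :
    ‖monomialMul α hα.transfer h (g - h) (a h) (b (g - h))‖ ≤ ‖a h‖ * ‖b (g - h)‖ :=
  norm_monomialMul_le hα (a.isCoeff h) (b.isCoeff (g - h))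

theorem summable_mul_term (a b : L1 α hα) (g : Γ) :
    Summable fun h => monomialMul α hα.transfer h (g - h) (a h) (b (g - h)) :=
  .of_norm_bounded ((summable_conv_prod a.summable_norm b.summable_norm).prod_factor g)
    fun h => a.norm_mul_term_le b g h

theorem norm_tsum_mul_term_le (a b : L1 α hα) (g : Γ) :
    ‖∑' h, monomialMul α hα.transfer h (g - h) (a h) (b (g - h))‖ ≤
      ∑' h, ‖a h‖ * ‖b (g - h)‖ :=
  tsum_of_norm_bounded
    ((summable_conv_prod a.summable_norm b.summable_norm).prod_factor g).hasSum
    fun h => a.norm_mul_term_le b g h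

/-- The product `(ab)_g = ∑_{h} c_h`, where `c_h` is the coefficient at `g` of the product of the
monomials `a_h δ_h` and `b_{g-h} δ_{g-h}`. -/
instance instMul : Mul (L1 α hα) where
  mul a b := mk (fun g => ∑' h, monomialMul α hα.transfer h (g - h) (a h) (b (g - h)))
    (.of_nonneg_of_le (fun _ => norm_nonneg _) (fun g => a.norm_tsum_mul_term_le b g)
      (summable_norm_conv a.summable_norm b.summable_norm))
    fun g => IsCoeff.tsum (a.summable_mul_term b g) fun h => by
      have := isCoeff_monomialMul hα.transfer_spec (a.isCoeff h) (b.isCoeff (g - h))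
      rwa [add_sub_cancel] at this

theorem mul_apply (a b : L1 α hα) (g : Γ) :
    (a * b) g = ∑' h, monomialMul α hα.transfer h (g - h) (a h) (b (g - h)) := rfl

instance instOne : One (L1 α hα) := ⟨single 0 1 (isCoeff_zero α 1)⟩

theorem one_apply (g : Γ) : (1 : L1 α hα) g = if g = 0 then 1 else 0 := rfl

/-- The involution `(a^*)_g = (a_{-g})^*`. -/
instance instStar : Star (L1 α hα) where
  star a := mk (fun g => star (a (-g)))
    (by
      simp only [norm_star]
      exact (Equiv.neg Γ).summable_iff.2 a.summable_norm)
    fun g => by simpa using (a.isCoeff (-g)).star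

theorem star_apply (a : L1 α hα) (g : Γ) : star a g = star (a (-g)) := rfl

theorem norm_mul_le' (a b : L1 α hα) : ‖a * b‖ ≤ ‖a‖ * ‖b‖ := by
  rw [← (a * b).hasSum_norm.tsum_eq, ← a.hasSum_norm.tsum_eq, ← b.hasSum_norm.tsum_eq,
    ← tsum_conv (f := fun g => ‖a g‖) (f' := fun g => ‖b g‖) (by simpa using a.summable_norm)
      (by simpa using b.summable_norm)]
  exact (a * b).summable_norm.tsum_le_tsum (fun g => a.norm_tsum_mul_term_le b g)
    (summable_norm_conv a.summable_norm b.summable_norm)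

section Rep

variable {H : Type w'} [NormedAddCommGroup H] [InnerProductSpace ℂ H] [CompleteSpace H]

theorem summable_norm_op (ρ : CovariantRep α hα.transfer H) (a : L1 α hα) :
    Summable fun g => ‖ρ.monomial g (a g)‖ :=
  .of_nonneg_of_le (fun _ => norm_nonneg _) (fun g => ρ.norm_monomial_le g (a g)) a.summable_norm

theorem op_mul (ρ : CovariantRep α hα.transfer H) (a b : L1 α hα) (g : Γ) :
    ρ.monomial g ((a * b) g) =
      ∑' h, ρ.monomial h (a h) * ρ.monomial (g - h) (b (g - h)) := by
  let m : A →L[ℂ] (H →L[ℂ] H) := LinearMap.mkContinuous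
    { toFun := ρ.monomial g, map_add' := ρ.monomial_add g, map_smul' := ρ.monomial_smul g } 1
    fun a => by rw [one_mul]; exact ρ.norm_monomial_le g a
  change m _ = _
  rw [mul_apply, m.map_tsum (a.summable_mul_term b g)]
  refine tsum_congr fun h => ?_
  rw [← ρ.monomial_mul (a.isCoeff h) (b.isCoeff (g - h)), add_sub_cancel]
  rfl

end Rep

theorem ext_op {a b : L1 α hα} (h : ∀ (H : Type w) [NormedAddCommGroup H] [InnerProductSpace ℂ H]
    [CompleteSpace H] (ρ : CovariantRep α hα.transfer H) (g : Γ),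
    ρ.monomial g (a g) = ρ.monomial g (b g)) : a = b := by
  obtain ⟨H, _, _, _, ρ, hρ⟩ := hα.exists_faithful
  refine ext fun g => ?_
  have hc : IsCoeff α g (a g + (-1 : ℂ) • b g) := (a.isCoeff g).add ((b.isCoeff g).smul _)
  have e := ρ.norm_monomial hρ hc
  rw [ρ.monomial_add, ρ.monomial_smul, h H ρ g, neg_one_smul, neg_one_smul, add_neg_cancel,
    norm_zero] at e
  rw [← sub_eq_zero, sub_eq_add_neg]
  exact norm_eq_zero.1 e.symm

section OpLemmas

variable {H : Type w'} [NormedAddCommGroup H] [InnerProductSpace ℂ H] [CompleteSpace H]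

theorem summable_op_mul (ρ : CovariantRep α hα.transfer H) (a b : L1 α hα) (g : Γ) :
    Summable fun h => ρ.monomial h (a h) * ρ.monomial (g - h) (b (g - h)) :=
  .of_norm_bounded
    ((summable_conv_prod (a.summable_norm_op ρ) (b.summable_norm_op ρ)).prod_factor g)
    fun _ => norm_mul_le _ _

theorem op_add (ρ : CovariantRep α hα.transfer H) (a b : L1 α hα) (g : Γ) :
    ρ.monomial g ((a + b) g) = ρ.monomial g (a g) + ρ.monomial g (b g) :=
  ρ.monomial_add g _ _

theorem op_smul (ρ : CovariantRep α hα.transfer H) (c : ℂ) (a : L1 α hα) (g : Γ) :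
    ρ.monomial g ((c • a) g) = c • ρ.monomial g (a g) :=
  ρ.monomial_smul g _ _

theorem op_star (ρ : CovariantRep α hα.transfer H) (a : L1 α hα) (g : Γ) :
    ρ.monomial g (star a g) = star (ρ.monomial (-g) (a (-g))) := by
  rw [star_apply, ← ρ.monomial_star, neg_neg]

theorem op_of_zero (ρ : CovariantRep α hα.transfer H) (g : Γ) : ρ.monomial g 0 = 0 := by
  have := ρ.monomial_smul g 0 0
  rwa [zero_smul, zero_smul] at this

theorem op_one (ρ : CovariantRep α hα.transfer H) (g : Γ) :
    ρ.monomial g ((1 : L1 α hα) g) = if g = 0 then 1 else 0 := by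
  rw [one_apply]
  split_ifs with h
  · rw [h, ρ.monomial_zero, map_one]
  · exact op_of_zero ρ g

end OpLemmas

instance instNormedRing : NormedRing (L1 α hα) where
  __ := instNormedAddCommGroup
  left_distrib a b c := ext_op fun H _ _ _ ρ g => by
    rw [op_add, op_mul, op_mul, op_mul, ← (a.summable_op_mul ρ b g).tsum_add
      (a.summable_op_mul ρ c g)]
    exact tsum_congr fun h => by rw [op_add, mul_add]
  right_distrib a b c := ext_op fun H _ _ _ ρ g => by
    rw [op_add, op_mul, op_mul, op_mul, ← (a.summable_op_mul ρ c g).tsum_add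
      (b.summable_op_mul ρ c g)]
    exact tsum_congr fun h => by rw [op_add, add_mul]
  zero_mul a := ext_op fun H _ _ _ ρ g => by
    rw [op_mul]; simp only [zero_apply, op_of_zero, zero_mul, tsum_zero]
  mul_zero a := ext_op fun H _ _ _ ρ g => by
    rw [op_mul]; simp only [zero_apply, op_of_zero, mul_zero, tsum_zero]
  mul_assoc a b c := ext_op fun H _ _ _ ρ g => by
    rw [op_mul, op_mul]
    simp only [op_mul]
    exact conv_assoc (f₁ := fun g => ρ.monomial g (a g)) (f₂ := fun g => ρ.monomial g (b g))
      (f₃ := fun g => ρ.monomial g (c g)) (a.summable_norm_op ρ) (b.summable_norm_op ρ)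
      (c.summable_norm_op ρ) g
  one_mul a := ext_op fun H _ _ _ ρ g => by
    rw [op_mul, tsum_eq_single 0 fun h hh => by rw [op_one, if_neg hh, zero_mul],
      op_one, if_pos rfl, one_mul, sub_zero]
  mul_one a := ext_op fun H _ _ _ ρ g => by
    rw [op_mul, tsum_eq_single g fun h hh => by
      rw [op_one, if_neg (sub_ne_zero.2 hh.symm), mul_zero], op_one, if_pos (sub_self g), mul_one]
  norm_mul_le := norm_mul_le'

instance instStarRing : StarRing (L1 α hα) where
  star_involutive a := ext fun g => by rw [star_apply, star_apply, star_star, neg_neg]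
  star_add a b := ext fun g => by
    rw [star_apply, add_apply, add_apply, star_apply, star_apply, star_add]
  star_mul a b := ext_op fun H _ _ _ ρ g => by
    rw [op_star, op_mul, op_mul, tsum_star, ← (Equiv.addLeft g).tsum_eq
      (fun h => ρ.monomial h (star b h) * ρ.monomial (g - h) (star a (g - h)))]
    refine tsum_congr fun h => ?_
    rw [op_star, op_star, star_mul, Equiv.coe_addLeft, neg_add', neg_sub, add_sub_cancel_left]

instance instAlgebra : Algebra ℂ (L1 α hα) :=
  Algebra.ofModule
    (fun c a b => ext_op fun H _ _ _ ρ g => by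
      rw [op_mul, op_smul, op_mul, ← (a.summable_op_mul ρ b g).tsum_const_smul]
      exact tsum_congr fun h => by rw [op_smul, smul_mul_assoc])
    (fun c a b => ext_op fun H _ _ _ ρ g => by
      rw [op_mul, op_smul, op_mul, ← (a.summable_op_mul ρ b g).tsum_const_smul]
      exact tsum_congr fun h => by rw [op_smul, mul_smul_comm])

instance instNormedAlgebra : NormedAlgebra ℂ (L1 α hα) where
  norm_smul_le c a := norm_smul_le c a

instance instStarModule : StarModule ℂ (L1 α hα) where
  star_smul c a := ext fun g => by
    rw [star_apply, smul_apply, smul_apply, star_apply, star_smul]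

instance instNormedStarGroup : NormedStarGroup (L1 α hα) where
  norm_star_le a := by
    rw [← (star a).hasSum_norm.tsum_eq, ← a.hasSum_norm.tsum_eq, ← (Equiv.neg Γ).tsum_eq]
    exact (tsum_congr fun g => by rw [star_apply, norm_star, Equiv.neg_apply, neg_neg]).le

end L1

/-- The representation `∑ a_g δ_g ↦ ∑_{x>0} U_x^* π(a_{-x}) + π(a_0) + ∑_{x>0} π(a_x) U_x` of
`ℓ¹(Γ, α, A)` given by a covariant representation. -/
def CovariantRep.l1Hom {α : EndAction Γ A} {hα : IsFinelyRepresentable.{u, v, w} α}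
    {H : Type w'} [NormedAddCommGroup H] [InnerProductSpace ℂ H] [CompleteSpace H]
    (ρ : CovariantRep α hα.transfer H) : L1 α hα →⋆ₐ[ℂ] (H →L[ℂ] H) :=
  have smul' (c : ℂ) (a : L1 α hα) :
      ∑' g, ρ.monomial g ((c • a) g) = c • ∑' g, ρ.monomial g (a g) := by
    rw [← (a.summable_norm_op ρ).of_norm.tsum_const_smul]
    exact tsum_congr fun g => L1.op_smul ρ c a g
  have one' : ∑' g, ρ.monomial g ((1 : L1 α hα) g) = 1 := by
    rw [tsum_eq_single 0 fun h hh => by rw [L1.op_one, if_neg hh], L1.op_one, if_pos rfl]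
  { toFun := fun a => ∑' g, ρ.monomial g (a g)
    map_one' := one'
    map_mul' := fun a b => by
      rw [← tsum_conv (f := fun g => ρ.monomial g (a g)) (f' := fun g => ρ.monomial g (b g))
        (a.summable_norm_op ρ) (b.summable_norm_op ρ)]
      exact tsum_congr fun g => L1.op_mul ρ a b g
    map_zero' := by simp only [L1.zero_apply, L1.op_of_zero, tsum_zero]
    map_add' := fun a b => by
      rw [← (a.summable_norm_op ρ).of_norm.tsum_add (b.summable_norm_op ρ).of_norm]
      exact tsum_congr fun g => L1.op_add ρ a b g
    commutes' := fun c => by rw [Algebra.algebraMap_eq_smul_one, smul', one',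
      Algebra.algebraMap_eq_smul_one]
    map_star' := fun a => by
      rw [tsum_star, ← (Equiv.neg Γ).tsum_eq]
      exact tsum_congr fun g => by rw [L1.op_star, Equiv.neg_apply, neg_neg] }

/-! ### The crossed product -/

/-- The crossed product of a finely representable system: the enveloping C⋆-algebra of
`ℓ¹(Γ, α, A)`. -/
abbrev CrossedProduct (α : EndAction Γ A) (hα : IsFinelyRepresentable.{u, v, w} α) :
    Type (max u v) := EnvelopingCStarAlgebra (L1 α hα)

namespace CrossedProduct

variable {α : EndAction Γ A} (hα : IsFinelyRepresentable.{u, v, w} α)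

/-- The element of the crossed product given by `a ∈ A`, that is, the class of `aδ_0`. -/
def ofA (a : A) : CrossedProduct α hα := toEnveloping (L1.single 0 a (isCoeff_zero α a))

/-- The element `u_x` of the crossed product, that is, the class of `α_x(1)δ_x`. -/
def u (x : PosCone Γ) : CrossedProduct α hα :=
  toEnveloping (L1.single (x : Γ) (α x 1) (isCoeff_cone α x))

/-- The element `∑_{x ∈ F} u_x^* c_{-x} + c_0 + ∑_{x ∈ F} c_x u_x` of the crossed product. -/
def finiteSum (F : Finset (PosCone Γ)) (c : Γ → A) : CrossedProduct α hα :=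
  ∑ x ∈ F, star (u hα x) * ofA hα (c (-(x : Γ))) + ofA hα (c 0) +
    ∑ x ∈ F, ofA hα (c (x : Γ)) * u hα x

end CrossedProduct

namespace CovariantRep

variable {α : EndAction Γ A} {hα : IsFinelyRepresentable.{u, v, w} α}
  {H : Type w'} [NormedAddCommGroup H] [InnerProductSpace ℂ H] [CompleteSpace H]

/-- The representation `π × U` of the crossed product. -/
def integrated (ρ : CovariantRep α hα.transfer H) : CrossedProduct α hα →⋆ₐ[ℂ] (H →L[ℂ] H) :=
  liftEnveloping ρ.l1Hom

/-- The property `‖a_0‖ ≤ ‖(π × U)(a)‖` for all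
`a = ∑_{x ∈ F} u_x^* a_{-x} + a_0 + ∑_{x ∈ F} a_x u_x` with `F ⊆ Γ⁺ \ {0}` finite, `a_0 ∈ A`,
`a_x ∈ A u_x u_x^* = A α_x(1)` and `a_{-x} ∈ u_x u_x^* A = α_x(1) A`. -/
def PropertyStar (ρ : CovariantRep α hα.transfer H) : Prop :=
  ∀ (F : Finset (PosCone Γ)) (c : Γ → A), 0 ∉ F →
    (∀ x ∈ F, IsCoeff α (x : Γ) (c x) ∧ IsCoeff α (-(x : Γ)) (c (-(x : Γ)))) →
    ‖c 0‖ ≤ ‖ρ.integrated (CrossedProduct.finiteSum hα F c)‖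

end CovariantRep

end Dynamics

end

/-! Both directions compare norms through the coefficients of a family, that is, through its Fourier
coefficients over `Γ`.

If `π × U` is injective, it is isometric, and the inequality says that taking the coefficient at `0`
is contractive for the norm of the crossed product. To see this, tensor a covariant representation
with faithful `π`, which fine representability provides, with the regular representation of `Γ`: on
`H ⊗ ℓ²(Γ)` let `a` act as `π(a) ⊗ 1` and `x` as `U_x ⊗ λ_x`. A monomial of degree `g` then
translates by `g`, so the `(0,0)` matrix entry of the image of a family is `π(a_0)`, and an entry is
bounded by the norm of the operator (`norm_coeff_zero_le_regular`,
`CrossedProduct.norm_coeff_zero_le`).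

Conversely, the inequality bounds the coefficient at `0`, and by shifting degrees every coefficient,
by the norm of the image under `π × U` (`PropertyStar.norm_coeff_le`). Let `b = a^* a`, with `a`
finitely supported, have its degrees in the finite set `S`. The enveloping norm of `b^k` is at most
its `ℓ¹` norm, hence at most the number of its possible degrees times `‖(π × U)(b^k)‖`. Since `Γ` is
abelian, `k • S` has at most `(k + 1)^|S|` elements. For `k = 2^n` both C⋆-norms turn powers of the
self-adjoint `b` into powers of norms, and `k`-th roots remove the polynomial factor. So `π × U`
does not decrease the norm of `b`, hence of `a`, and by density of any element
(`PropertyStar.norm_toEnveloping_le_of_supportedOn`, `PropertyStar.injective`). -/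

noncomputable section

open Filter Topology
open scoped Pointwise

/-! ### Polynomial growth and the removal of polynomial factors -/

/-- Finite sumsets in an abelian group grow polynomially. -/
theorem Finset.card_nsmul_le_pow {G : Type*} [AddCommGroup G] [DecidableEq G] (s : Finset G)
    (n : ℕ) : (n • s).card ≤ (n + 1) ^ s.card := by
  -- By commutativity a sum of `n` elements of `s` depends only on how often each element occurs,
  -- and each multiplicity takes one of the `n + 1` values `0, …, n`.
  have hsub : n • s ⊆ (Fintype.piFinset fun _ : s => Finset.range (n + 1)).image
      fun f => ∑ x : s, f x • (x : G) := by
    intro a ha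
    obtain ⟨f, rfl⟩ := Finset.mem_nsmul.1 ha
    refine Finset.mem_image.2 ⟨fun x => (Finset.univ.filter fun i => f i = x).card, ?_, ?_⟩
    · refine Fintype.mem_piFinset.2 fun x => Finset.mem_range.2 (Nat.lt_succ_of_le ?_)
      exact (Finset.card_filter_le _ _).trans_eq (by simp)
    · rw [List.sum_ofFn, ← Finset.sum_fiberwise Finset.univ f fun i => (f i : G)]
      refine Finset.sum_congr rfl fun x _ => ?_
      rw [Finset.sum_congr rfl fun i hi => congrArg Subtype.val (Finset.mem_filter.1 hi).2,
        Finset.sum_const]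
  refine (Finset.card_le_card hsub).trans (Finset.card_image_le.trans_eq ?_)
  simp [Fintype.card_piFinset]

/-- A polynomial factor along a sequence of powers of `2` does not affect the comparison of two
nonnegative numbers by their powers. -/
theorem le_of_pow_two_pow_le {p q : ℝ} (hp : 0 ≤ p) (hq : 0 ≤ q) (m : ℕ)
    (h : ∀ n : ℕ, p ^ 2 ^ n ≤ ((2 ^ n + 1 : ℕ) : ℝ) ^ m * q ^ 2 ^ n) : p ≤ q := by
  by_contra! hlt
  have hp0 : 0 < p := hq.trans_lt hlt
  -- One extra factor `q / p` makes the exponent equal to the base `k = 2 ^ n + 1` of the polynomial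
  -- factor, so the bound is a subsequence of `k ^ m * (q / p) ^ k`, which tends to `0`.
  have h1 (n : ℕ) : q / p ≤ ((2 ^ n + 1 : ℕ) : ℝ) ^ m * (q / p) ^ (2 ^ n + 1) := by
    have : 1 ≤ ((2 ^ n + 1 : ℕ) : ℝ) ^ m * (q / p) ^ 2 ^ n := by
      rw [div_pow, ← mul_div_assoc, one_le_div (by positivity)]
      exact h n
    calc q / p = 1 * (q / p) := (one_mul _).symm
      _ ≤ _ := by rw [pow_succ, ← mul_assoc]; gcongr
  have ht := (tendsto_pow_const_mul_const_pow_of_lt_one m (div_nonneg hq hp)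
    ((div_lt_one hp0).2 hlt)).comp ((tendsto_add_atTop_nat 1).comp
      (tendsto_pow_atTop_atTop_of_one_lt one_lt_two))
  have hq0 : q / p ≤ 0 := ge_of_tendsto' ht h1
  have h2 : q = 0 := by
    have := le_antisymm hq0 (div_nonneg hq hp)
    exact (div_eq_zero_iff.1 this).resolve_right hp0.ne'
  -- With `q = 0` the hypothesis at `n = 0` already says `p ≤ 0`.
  have := h 0
  rw [h2] at this
  simp at this
  linarith

/-! ### Translation operators on `ℓ²(G, H)` -/

namespace lp

theorem hasSum_norm_sq {ι E : Type*} [NormedAddCommGroup E] (ξ : lp (fun _ : ι => E) 2) :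
    HasSum (fun g => ‖ξ g‖ ^ 2) (‖ξ‖ ^ 2) := by
  have := lp.hasSum_norm (p := 2) (by simp) ξ
  simpa using this

variable {G : Type*} [AddCommGroup G] {H : Type*} [NormedAddCommGroup H]
  [InnerProductSpace ℂ H]

theorem memℓp_two_shift (g : G) (T : H →L[ℂ] H) (ξ : lp (fun _ : G => H) 2) :
    Memℓp (fun h => T (ξ (h - g)) : G → H) 2 := by
  refine (memℓp_gen_iff (by simp)).2 ?_
  have h1 := ((Equiv.subRight g).summable_iff.2 (hasSum_norm_sq ξ).summable).mul_left (‖T‖ ^ 2)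
  refine Summable.of_nonneg_of_le (fun h => by positivity) (fun h => ?_) h1
  have := T.le_opNorm (ξ (h - g))
  simp only [ENNReal.toReal_ofNat, Real.rpow_ofNat, Function.comp_apply, Equiv.subRight_apply]
  rw [← mul_pow]
  gcongr

/-- The operator on `ℓ²(G, H) = H ⊗ ℓ²(G)` given by `T` on `H` and translation by `g` on `ℓ²(G)`. -/
def shift (g : G) (T : H →L[ℂ] H) : lp (fun _ : G => H) 2 →L[ℂ] lp (fun _ : G => H) 2 :=
  LinearMap.mkContinuous
    { toFun := fun ξ => ⟨fun h => T (ξ (h - g)), memℓp_two_shift g T ξ⟩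
      map_add' := fun ξ η => lp.ext (funext fun h => by
        simp only [lp.coeFn_add, Pi.add_apply, map_add])
      map_smul' := fun c ξ => lp.ext (funext fun h => by
        simp only [lp.coeFn_smul, Pi.smul_apply, map_smul, RingHom.id_apply]) }
    ‖T‖ fun ξ => by
      refine abs_le_of_sq_le_sq' ?_ (by positivity) |>.2
      have h1 := ((Equiv.subRight g).hasSum_iff.2 (hasSum_norm_sq ξ)).mul_left (‖T‖ ^ 2)
      rw [mul_pow]
      refine hasSum_le (fun h => ?_) (hasSum_norm_sq _) h1
      rw [Function.comp_apply, Equiv.subRight_apply, ← mul_pow]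
      gcongr
      exact T.le_opNorm (ξ (h - g))

theorem shift_apply (g : G) (T : H →L[ℂ] H) (ξ : lp (fun _ : G => H) 2) (h : G) :
    shift g T ξ h = T (ξ (h - g)) := rfl

/-- The two tensor factors multiply independently. Together with `star_shift` this carries the
relations between `π` and `U` over to the regular representation. -/
theorem shift_mul (g h : G) (S T : H →L[ℂ] H) : shift g S * shift h T = shift (g + h) (S * T) := by
  ext ξ k
  simp only [mul_apply_eq_comp, shift_apply, sub_sub]

variable [CompleteSpace H]

theorem star_shift (g : G) (T : H →L[ℂ] H) : star (shift g T) = shift (-g) (star T) := by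
  rw [ContinuousLinearMap.star_eq_adjoint, eq_comm, ContinuousLinearMap.eq_adjoint_iff]
  intro ξ η
  rw [lp.inner_eq_tsum, lp.inner_eq_tsum, ← (Equiv.subRight g).tsum_eq]
  refine tsum_congr fun h => ?_
  rw [shift_apply, shift_apply, ContinuousLinearMap.star_eq_adjoint,
    ContinuousLinearMap.adjoint_inner_left, Equiv.subRight_apply, sub_neg_eq_add, sub_add_cancel]

end lp

/-! ### The regular representation of a covariant representation -/

namespace CovariantRep

variable {Γ : Type u} {A : Type v} [AddCommGroup Γ] [LinearOrder Γ] [IsOrderedAddMonoid Γ]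
  [CStarAlgebra A] {α : EndAction Γ A} {L : PosCone Γ → (A →L[ℂ] A)}
  {H : Type w'} [NormedAddCommGroup H] [InnerProductSpace ℂ H] [CompleteSpace H]

/-- The covariant representation on `H ⊗ ℓ²(Γ)` with `a ↦ π(a) ⊗ 1` and `x ↦ U_x ⊗ λ_x`, where `λ`
is the regular representation of `Γ`. -/
def regular (ρ : CovariantRep α L H) : CovariantRep α L (lp (fun _ : Γ => H) 2) where
  π :=
    { toFun := fun a => lp.shift 0 (ρ.π a)
      map_one' := by ext ξ k; simp [lp.shift_apply]
      map_mul' := fun a b => by rw [lp.shift_mul, add_zero, map_mul]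
      map_zero' := by ext ξ k; simp [lp.shift_apply]
      map_add' := fun a b => by ext ξ k; simp [lp.shift_apply]
      commutes' := fun c => by
        ext ξ k
        simp [lp.shift_apply, Algebra.algebraMap_eq_smul_one]
      map_star' := fun a => by rw [lp.star_shift, neg_zero, map_star] }
  U x := lp.shift (x : Γ) (ρ.U x)
  U_add x y := by rw [lp.shift_mul, ρ.U_add]; rfl
  -- The translations by `x`, `0` and `-x` compose to the identity, so the covariance relation on
  -- `H` is all that remains.
  conj x a := by
    change _ * lp.shift 0 _ * _ = lp.shift 0 _
    rw [lp.star_shift, lp.shift_mul, lp.shift_mul, ρ.conj, add_zero, add_neg_cancel]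
  conj_star x a := by
    change _ * lp.shift 0 _ * _ = lp.shift 0 _
    rw [lp.star_shift, lp.shift_mul, lp.shift_mul, ρ.conj_star, add_zero, neg_add_cancel]

/-- Tensoring with `λ` records the degree of a monomial as a translation, so that matrix entries can
separate the coefficients of a family. -/
theorem regular_monomial (ρ : CovariantRep α L H) (g : Γ) (a : A) :
    ρ.regular.monomial g a = lp.shift g (ρ.monomial g a) := by
  have hU (x : PosCone Γ) : ρ.regular.U x = lp.shift (x : Γ) (ρ.U x) := rfl
  have hπ (a : A) : ρ.regular.π a = lp.shift 0 (ρ.π a) := rfl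
  rcases le_total 0 g with h | h
  · rw [monomial_nonneg _ h, monomial_nonneg _ h, hU, hπ, lp.shift_mul, zero_add]
    simp [toCone, h]
  · rw [monomial_nonpos _ h, monomial_nonpos _ h, hU, hπ, lp.star_shift, lp.shift_mul, add_zero]
    simp [toCone, h]

/-- The conditional expectation onto `A` is contractive in the regular representation. -/
theorem norm_coeff_zero_le_regular {hα : IsFinelyRepresentable.{u, v, w} α}
    (ρ : CovariantRep α hα.transfer H) (hρ : Function.Injective ρ.π) (a : L1 α hα) :
    ‖a 0‖ ≤ ‖ρ.regular.l1Hom a‖ := by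
  rw [← NonUnitalStarAlgHom.norm_map ρ.π hρ (a 0)]
  refine ContinuousLinearMap.opNorm_le_bound _ (norm_nonneg _) fun ξ => ?_
  have hs : HasSum (fun g => ρ.regular.monomial g (a g)) (ρ.regular.l1Hom a) :=
    (a.summable_norm_op ρ.regular).of_norm.hasSum
  -- Apply the operator to `ξ ⊗ e_0` and read off the component at `0`; both operations are
  -- continuous and linear, so they pass through the sum.
  have h1 := (hs.mapL (ContinuousLinearMap.apply ℂ _ (lp.single 2 (0 : Γ) ξ))).mapL
    (lp.evalCLM ℂ (fun _ : Γ => H) 2 0)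
  have h2 : HasSum (fun g => (lp.shift g (ρ.monomial g (a g)) (lp.single 2 (0 : Γ) ξ)) 0)
      ((ρ.regular.l1Hom a (lp.single 2 (0 : Γ) ξ)) 0) := by
    simp only [← regular_monomial]
    exact h1
  -- The term of degree `g` moves `e_0` to `e_g`, so only `g = 0` contributes at `0`.
  have h3 : (ρ.regular.l1Hom a (lp.single 2 (0 : Γ) ξ)) 0 = ρ.π (a 0) ξ := by
    refine h2.unique ?_
    convert hasSum_single (0 : Γ) fun g hg => ?_ using 1
    · rw [lp.shift_apply, sub_zero, lp.single_apply_self, monomial_zero]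
    · rw [lp.shift_apply, lp.single_apply_ne _ _ _ (by simpa using hg), map_zero]
  rw [← h3]
  calc _ ≤ ‖ρ.regular.l1Hom a (lp.single 2 (0 : Γ) ξ)‖ := lp.norm_apply_le_norm two_ne_zero _ _
    _ ≤ _ := ContinuousLinearMap.le_opNorm _ _
    _ = _ := by rw [lp.norm_single (by simp)]

end CovariantRep

/-! ### Monomials and finitely supported families in `ℓ¹(Γ, α, A)` -/

section CrossedProduct

variable {Γ : Type u} {A : Type v} [AddCommGroup Γ] [LinearOrder Γ] [IsOrderedAddMonoid Γ]
  [CStarAlgebra A] {α : EndAction Γ A} {hα : IsFinelyRepresentable.{u, v, w} α}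

theorem norm_coneOne_le (α : EndAction Γ A) (x : PosCone Γ) : ‖α x 1‖ ≤ 1 := by
  have h2 : ‖α x 1‖ * ‖α x 1‖ = ‖α x 1‖ := by
    rw [← CStarRing.norm_self_mul_star, α.star_one, α.one_mul_one]
  nlinarith [norm_nonneg (α x 1)]

/-- This and the next lemma compute `u_x^* b` and `b u_x`. The projection `α_x(1)` disappears
because the coefficient condition on `b` says precisely that it absorbs it. -/
theorem monomialMul_neg_zero (L : PosCone Γ → (A →L[ℂ] A)) {x : Γ} (hx : 0 < x) {b : A}
    (hb : IsCoeff α (-x) b) : monomialMul α L (-x) 0 (α (toCone x) 1) b = b := by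
  have := hb.left (neg_nonpos.2 hx.le)
  rw [neg_neg] at this
  rw [monomialMul, if_neg (by simp), if_neg (by simp), if_neg (by simpa using hx), neg_zero,
    toCone_zero, α.map_zero', this]

theorem monomialMul_zero_pos (L : PosCone Γ → (A →L[ℂ] A)) {x : Γ} (hx : 0 < x) {b : A}
    (hb : IsCoeff α x b) : monomialMul α L 0 x b (α (toCone x) 1) = b := by
  rw [monomialMul, if_neg (by simp), if_neg (by simp), if_pos (by simpa using hx.le),
    toCone_zero, α.map_zero', hb.right hx.le]

/-- Right multiplication by `u_x^*` carries the coefficient at `x` to degree `0` unchanged, which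
reduces bounds on all coefficients to a bound at `0`. -/
theorem monomialMul_self_neg (L : PosCone Γ → (A →L[ℂ] A)) {x : Γ} (hx : 0 ≤ x) {b : A}
    (hb : IsCoeff α x b) : monomialMul α L x (-x) b (α (toCone x) 1) = b := by
  have h : b * α (toCone x) 1 = b := hb.right hx
  -- The mixed-sign branch of `monomialMul` requires strict inequalities, so `x = 0` falls under
  -- another branch.
  rcases hx.eq_or_lt with rfl | hx'
  · simp [monomialMul, toCone_zero, α.map_zero']
  · rw [monomialMul, if_pos ⟨hx', neg_neg_iff_pos.2 hx'⟩, add_neg_cancel, if_pos le_rfl,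
      toCone_zero, α.map_zero', h]

namespace L1

theorem norm_single (g : Γ) (a : A) (ha : IsCoeff α g a) :
    ‖(single g a ha : L1 α hα)‖ = ‖a‖ := by
  rw [← (single g a ha : L1 α hα).hasSum_norm.tsum_eq, tsum_eq_single g fun h hh => by
    rw [single_apply, if_neg hh, norm_zero], single_apply, if_pos rfl]

theorem mul_single_apply (a : L1 α hα) (g h : Γ) {b : A} (hb : IsCoeff α h b) :
    (a * single h b hb) g = monomialMul α hα.transfer (g - h) h (a (g - h)) b := by
  rw [mul_apply, tsum_eq_single (g - h) fun k hk => ?_]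
  · rw [sub_sub_cancel, single_apply, if_pos rfl]
  · have : g - k ≠ h := fun e => hk (by rw [← e, sub_sub_cancel])
    rw [single_apply, if_neg this]
    simp [monomialMul]

theorem single_mul_single {g h : Γ} {a b : A} (ha : IsCoeff α g a) (hb : IsCoeff α h b) :
    (single g a ha * single h b hb : L1 α hα) =
      single (g + h) (monomialMul α hα.transfer g h a b)
        (isCoeff_monomialMul hα.transfer_spec ha hb) := by
  refine ext fun k => ?_
  rw [mul_single_apply, single_apply, single_apply]
  by_cases hk : k = g + h
  · rw [if_pos hk, if_pos (by rw [hk, add_sub_cancel_right]), hk, add_sub_cancel_right]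
  · rw [if_neg hk, if_neg fun e => hk (by rw [← e, sub_add_cancel])]
    simp [monomialMul]

theorem star_single {g : Γ} {a : A} (ha : IsCoeff α g a) :
    star (single g a ha : L1 α hα) = single (-g) (star a) ha.star := by
  refine ext fun k => ?_
  rw [star_apply, single_apply, single_apply]
  simp only [neg_eq_iff_eq_neg]
  split_ifs <;> simp

theorem single_congr {g h : Γ} {a b : A} (ha : IsCoeff α g a) (hb : IsCoeff α h b) (e : g = h)
    (e' : a = b) : (single g a ha : L1 α hα) = single h b hb := by
  subst e e'; rfl

theorem sum_apply {ι : Type*} (s : Finset ι) (f : ι → L1 α hα) (g : Γ) :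
    (∑ i ∈ s, f i) g = ∑ i ∈ s, f i g := by
  classical
  induction s using Finset.induction_on with
  | empty => rfl
  | insert i s hi ih => rw [Finset.sum_insert hi, Finset.sum_insert hi, add_apply, ih]

/-- The restriction of the family `a` to a finite set. -/
def restrict (s : Finset Γ) (a : L1 α hα) : L1 α hα := ∑ g ∈ s, single g (a g) (a.isCoeff g)

theorem restrict_apply (s : Finset Γ) (a : L1 α hα) (g : Γ) :
    restrict s a g = if g ∈ s then a g else 0 := by
  rw [restrict, sum_apply]
  simp only [single_apply]
  exact Finset.sum_ite_eq s g a.1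

/-- The monomials of `a` are absolutely summable, so their sum exists by completeness; coordinates
are continuous, and each one is eventually constant along the finite restrictions, which identifies
the sum as `a`. -/
theorem tendsto_restrict (a : L1 α hα) : Tendsto (fun s => restrict s a) atTop (𝓝 a) := by
  have hs : Summable fun g => (single g (a g) (a.isCoeff g) : L1 α hα) :=
    .of_norm (by simpa only [norm_single] using a.summable_norm)
  have hc (g : Γ) : Continuous fun b : L1 α hα => b g :=
    ((continuous_apply g).comp lp.uniformContinuous_coe.continuous).comp continuous_subtype_val
  have e : ∑' g, (single g (a g) (a.isCoeff g) : L1 α hα) = a := by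
    refine ext fun k => tendsto_nhds_unique ((hc k).continuousAt.tendsto.comp hs.hasSum) ?_
    refine tendsto_const_nhds.congr' ?_
    filter_upwards [eventually_ge_atTop {k}] with s hk
    have := restrict_apply s a k
    rw [if_pos (Finset.singleton_subset_iff.1 hk)] at this
    exact this.symm
  have := hs.hasSum
  rwa [e] at this

/-- The family `a` vanishes outside the finite set `s`. -/
def SupportedOn (s : Finset Γ) (a : L1 α hα) : Prop := ∀ g, g ∉ s → a g = 0

theorem supportedOn_restrict (s : Finset Γ) (a : L1 α hα) : SupportedOn s (restrict s a) :=
  fun g hg => by rw [restrict_apply, if_neg hg]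

theorem SupportedOn.star {s : Finset Γ} {a : L1 α hα} (ha : SupportedOn s a) :
    SupportedOn (-s) (star a) := fun g hg => by
  rw [star_apply, ha _ fun h => hg (Finset.mem_neg'.2 h), star_zero]

/-- Degrees add in every branch of `monomialMul`. Hence powers of a family live on iterated sumsets,
whose size `Finset.card_nsmul_le_pow` controls. -/
theorem SupportedOn.mul {s t : Finset Γ} {a b : L1 α hα} (ha : SupportedOn s a)
    (hb : SupportedOn t b) : SupportedOn (s + t) (a * b) := fun g hg => by
  rw [mul_apply, ← tsum_zero (β := Γ)]
  refine tsum_congr fun h => ?_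
  by_cases h1 : h ∈ s
  · have : g - h ∉ t := fun h2 => hg (by simpa using Finset.add_mem_add h1 h2)
    rw [hb _ this]; simp [monomialMul]
  · rw [ha _ h1]; simp [monomialMul]

theorem SupportedOn.pow {s : Finset Γ} {a : L1 α hα} (ha : SupportedOn s a) (n : ℕ) :
    SupportedOn (n • s) (a ^ n) := by
  induction n with
  | zero =>
    intro g hg
    rw [zero_nsmul, Finset.mem_zero] at hg
    rw [pow_zero, one_apply, if_neg hg]
  | succ n ih => rw [succ_nsmul, pow_succ]; exact ih.mul ha

/-- Passing from a uniform bound on coefficients to an `ℓ¹` bound costs the number of degrees; along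
powers of a fixed family this cost grows only polynomially. -/
theorem SupportedOn.norm_le {s : Finset Γ} {a : L1 α hα} (ha : SupportedOn s a) {r : ℝ}
    (hr : ∀ g, ‖a g‖ ≤ r) : ‖a‖ ≤ s.card * r := by
  rw [← a.hasSum_norm.tsum_eq, tsum_eq_sum fun g hg => by rw [ha g hg, norm_zero], ← nsmul_eq_mul]
  exact Finset.sum_le_card_nsmul s _ r fun g _ => hr g

end L1

theorem norm_toEnveloping_le (a : L1 α hα) : ‖toEnveloping a‖ ≤ ‖a‖ :=
  norm_starAlgHom_le (C := CrossedProduct α hα) toEnveloping a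

/-! ### Finite sums in the crossed product and the expectation onto `A` -/

namespace CrossedProduct

theorem star_u_mul_ofA {x : PosCone Γ} (hx : x ≠ 0) {b : A} (hb : IsCoeff α (-(x : Γ)) b) :
    star (u hα x) * ofA hα b = toEnveloping (L1.single (-(x : Γ)) b hb) := by
  have hx' : 0 < (x : Γ) := x.2.lt_of_ne fun e => hx (Subtype.ext e.symm)
  rw [u, ofA, ← map_star, ← map_mul, L1.star_single, L1.single_mul_single]
  congr 1
  refine L1.single_congr _ _ (add_zero _) ?_
  have := monomialMul_neg_zero hα.transfer hx' hb
  rw [toCone_coe] at this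
  rw [α.star_one, this]

theorem ofA_mul_u {x : PosCone Γ} (hx : x ≠ 0) {b : A} (hb : IsCoeff α (x : Γ) b) :
    ofA hα b * u hα x = toEnveloping (L1.single (x : Γ) b hb) := by
  have hx' : 0 < (x : Γ) := x.2.lt_of_ne fun e => hx (Subtype.ext e.symm)
  rw [u, ofA, ← map_mul, L1.single_mul_single]
  congr 1
  refine L1.single_congr _ _ (zero_add _) ?_
  have := monomialMul_zero_pos hα.transfer hx' hb
  rwa [toCone_coe] at this

/-- An element of the form `finiteSum F c` is the class of a family with coefficients `c_g` at
`|g| ∈ F ∪ {0}`. -/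
theorem exists_finiteSum_eq (F : Finset (PosCone Γ)) (c : Γ → A) (h0 : 0 ∉ F)
    (hc : ∀ x ∈ F, IsCoeff α (x : Γ) (c x) ∧ IsCoeff α (-(x : Γ)) (c (-(x : Γ)))) :
    ∃ d : L1 α hα, finiteSum hα F c = toEnveloping d ∧
      ∀ g, d g = if g = 0 ∨ toCone |g| ∈ F then c g else 0 := by
  have hF (x : F) : x.1 ≠ 0 := fun e => h0 (e ▸ x.2)
  refine ⟨∑ x : F, L1.single (-(x : Γ)) (c (-(x : Γ))) (hc x x.2).2 +
    L1.single 0 (c 0) (isCoeff_zero α _) + ∑ x : F, L1.single (x : Γ) (c x) (hc x x.2).1, ?_, ?_⟩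
  · rw [map_add, map_add, map_sum, map_sum, finiteSum, ← Finset.sum_coe_sort F,
      ← Finset.sum_coe_sort F]
    congr 1
    · congr 1
      exact Finset.sum_congr rfl fun x _ => star_u_mul_ofA (hF x) _
    · exact Finset.sum_congr rfl fun x _ => ofA_mul_u (hF x) _
  · intro g
    simp only [L1.add_apply, L1.sum_apply, L1.single_apply]
    have pos (x : F) : 0 < (x : Γ) := x.1.2.lt_of_ne fun e => hF x (Subtype.ext e.symm)
    -- Since `0 ∉ F`, the degrees in the three groups of monomials are negative, zero and positive.
    -- So the sign of `g` selects one group, and at most one `x ∈ F` in it has degree `g`.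
    rcases lt_trichotomy g 0 with hg | rfl | hg
    · have hx (x : F) : (g = x) = False := eq_false (hg.trans (pos x)).ne
      simp only [hx, hg.ne, if_false, Finset.sum_const_zero, add_zero, false_or, abs_of_neg hg]
      split_ifs with hm
      · rw [Finset.sum_eq_single (⟨_, hm⟩ : F)]
        · simp [toCone, hg.le]
        · intro b _ hb
          refine if_neg fun e => hb (Subtype.ext ?_)
          change _ = toCone (-g)
          rw [e, neg_neg, toCone_coe]
        · simp
      · refine Finset.sum_eq_zero fun x _ => if_neg fun e => hm ?_
        rw [e, neg_neg, toCone_coe]; exact x.2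
    · have h1 (x : F) : ((0 : Γ) = x) = False := eq_false (pos x).ne
      have h2 (x : F) : ((0 : Γ) = -x) = False := eq_false (neg_neg_iff_pos.2 (pos x)).ne'
      simp [h1, h2]
    · have hx (x : F) : (g = -x) = False :=
        eq_false ((neg_neg_iff_pos.2 (pos x)).trans hg).ne'
      simp only [hx, hg.ne', if_false, Finset.sum_const_zero, zero_add, false_or, abs_of_pos hg]
      split_ifs with hm
      · rw [Finset.sum_eq_single (⟨_, hm⟩ : F)]
        · simp [toCone, hg.le]
        · intro b _ hb
          refine if_neg fun e => hb (Subtype.ext ?_)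
          change _ = toCone g
          rw [e, toCone_coe]
        · simp
      · refine Finset.sum_eq_zero fun x _ => if_neg fun e => hm ?_
        rw [e, toCone_coe]; exact x.2

/-- The conditional expectation of the crossed product onto `A` is well defined and contractive. -/
theorem norm_coeff_zero_le (a : L1 α hα) : ‖a 0‖ ≤ ‖toEnveloping a‖ := by
  -- The representation used here comes from fine representability and has nothing to do with the
  -- one in the theorem; only the faithfulness of its `π` matters.
  obtain ⟨H, _, _, _, ρ, hρ⟩ := hα.exists_faithful
  refine (ρ.norm_coeff_zero_le_regular hρ a).trans ?_
  rw [← liftEnveloping_apply]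
  exact NonUnitalStarAlgHom.norm_apply_le (liftEnveloping ρ.regular.l1Hom) _

end CrossedProduct

/-! ### The two implications -/

namespace CovariantRep

variable {H : Type w'} [NormedAddCommGroup H] [InnerProductSpace ℂ H] [CompleteSpace H]
  (ρ : CovariantRep α hα.transfer H)

theorem integrated_toEnveloping (a : L1 α hα) : ρ.integrated (toEnveloping a) = ρ.l1Hom a :=
  liftEnveloping_apply _ _

theorem continuous_l1Hom : Continuous ρ.l1Hom :=
  AddMonoidHomClass.continuous_of_bound ρ.l1Hom 1 fun a => by
    rw [one_mul]; exact norm_starAlgHom_le ρ.l1Hom a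

/-- An injective `*`-homomorphism of C⋆-algebras is isometric, so the inequality is the
contractivity of the expectation, which holds in the crossed product itself. -/
theorem propertyStar_of_injective (h : Function.Injective ρ.integrated) : ρ.PropertyStar := by
  intro F c h0 hc
  obtain ⟨d, hd, hd'⟩ := CrossedProduct.exists_finiteSum_eq (hα := hα) F c h0 hc
  have h1 := CrossedProduct.norm_coeff_zero_le d
  rw [hd', if_pos (Or.inl rfl)] at h1
  rw [NonUnitalStarAlgHom.norm_map ρ.integrated h, hd]
  exact h1

variable {ρ}

/-- Truncations of `a` to finite sets containing `0` have the same coefficient at `0`, and their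
images converge, so the inequality for finite sums passes to the limit. -/
theorem PropertyStar.norm_coeff_zero_le (h : ρ.PropertyStar) (a : L1 α hα) :
    ‖a 0‖ ≤ ‖ρ.l1Hom a‖ := by
  have key (s : Finset Γ) (hs : 0 ∈ s) : ‖a 0‖ ≤ ‖ρ.l1Hom (L1.restrict s a)‖ := by
    -- `F` keeps only absolute values, so it may bring in `-g` when just `g` lies in `s`. Taking the
    -- coefficients from the restriction rather than from `a` makes these extra terms zero.
    let F : Finset (PosCone Γ) := (s.image fun g => toCone |g|).erase 0
    let c : Γ → A := L1.restrict s a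
    have hF : (0 : PosCone Γ) ∉ F := Finset.notMem_erase _ _
    have hc : ∀ x ∈ F, IsCoeff α (x : Γ) (c x) ∧ IsCoeff α (-(x : Γ)) (c (-(x : Γ))) :=
      fun x _ => ⟨L1.isCoeff _ _, L1.isCoeff _ _⟩
    obtain ⟨d, hd, hd'⟩ := CrossedProduct.exists_finiteSum_eq (hα := hα) F c hF hc
    have e : d = L1.restrict s a := by
      refine L1.ext fun g => ?_
      rw [hd']
      split_ifs with hg
      · rfl
      · rw [L1.supportedOn_restrict s a g fun hgs => hg ?_]
        by_cases h0 : g = 0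
        · exact Or.inl h0
        · refine Or.inr (Finset.mem_erase.2 ⟨fun e => h0 ?_, Finset.mem_image_of_mem _ hgs⟩)
          have := congrArg Subtype.val e
          simpa [toCone] using this
    have h1 := h F c hF hc
    rw [hd, integrated_toEnveloping, e] at h1
    have h2 : c 0 = a 0 := by
      change L1.restrict s a 0 = _
      rw [L1.restrict_apply, if_pos hs]
    rwa [h2] at h1
  refine ge_of_tendsto ((ρ.continuous_l1Hom.norm.tendsto a).comp a.tendsto_restrict) ?_
  filter_upwards [eventually_ge_atTop {0}] with s hs
  exact key s (Finset.singleton_subset_iff.1 hs)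

/-- For `x ≥ 0`, apply the bound at `0` to the product with `u_x^*`, whose image has norm at most
`1` because `α_x(1)` is a projection. The involution handles negative degrees. -/
theorem PropertyStar.norm_coeff_le (h : ρ.PropertyStar) (a : L1 α hα) (g : Γ) :
    ‖a g‖ ≤ ‖ρ.l1Hom a‖ := by
  have key (b : L1 α hα) {x : Γ} (hx : 0 ≤ x) : ‖b x‖ ≤ ‖ρ.l1Hom b‖ := by
    have hc : IsCoeff α (-x) (α (toCone x) 1) :=
      isCoeff_of_nonpos (neg_nonpos.2 hx) (by rw [neg_neg, α.one_mul_one])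
    have h1 := h.norm_coeff_zero_le (b * L1.single (-x) _ hc)
    rw [L1.mul_single_apply, zero_sub, neg_neg, monomialMul_self_neg _ hx (b.isCoeff x),
      map_mul] at h1
    refine h1.trans ((norm_mul_le _ _).trans (mul_le_of_le_one_right (norm_nonneg _) ?_))
    refine (norm_starAlgHom_le ρ.l1Hom _).trans ?_
    rw [L1.norm_single]
    exact norm_coneOne_le α _
  rcases le_total 0 g with hg | hg
  · exact key a hg
  · have := key (star a) (neg_nonneg.2 hg)
    rwa [L1.star_apply, neg_neg, norm_star, map_star, norm_star] at this

/-- This is a spectral radius argument: the `ℓ¹` norm of a power exceeds the norm of its image at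
most by a polynomial factor, which is invisible after taking roots. Passing to `star a * a` makes
the element self-adjoint, so that norms of its powers of exponent `2 ^ n` are powers of its norm. -/
theorem PropertyStar.norm_toEnveloping_le_of_supportedOn (h : ρ.PropertyStar) {s : Finset Γ}
    {a : L1 α hα} (ha : L1.SupportedOn s a) : ‖toEnveloping a‖ ≤ ‖ρ.l1Hom a‖ := by
  have hsa : IsSelfAdjoint (star a * a) := .star_mul_self a
  have hsupp := ha.star.mul ha
  have h1 : ‖toEnveloping (star a * a)‖ ≤ ‖ρ.l1Hom (star a * a)‖ := by
    -- The degree of the polynomial factor is the size of the support of `star a * a`, independent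
    -- of `n`.
    refine le_of_pow_two_pow_le (norm_nonneg _) (norm_nonneg _) (-s + s).card fun n => ?_
    rw [← (hsa.map (toEnveloping (B := L1 α hα))).norm_pow_two_pow,
      ← (hsa.map ρ.l1Hom).norm_pow_two_pow, ← map_pow, ← map_pow]
    calc _ ≤ ‖(star a * a) ^ 2 ^ n‖ := norm_toEnveloping_le _
      _ ≤ _ := (hsupp.pow (2 ^ n)).norm_le (h.norm_coeff_le _)
      _ ≤ _ := by
        gcongr
        exact_mod_cast Finset.card_nsmul_le_pow (-s + s) (2 ^ n)
  rw [map_mul, map_mul, map_star, map_star, CStarRing.norm_star_mul_self,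
    CStarRing.norm_star_mul_self] at h1
  exact abs_le_of_sq_le_sq' (by simpa only [sq] using h1) (norm_nonneg _) |>.2

theorem PropertyStar.norm_toEnveloping_le (h : ρ.PropertyStar) (a : L1 α hα) :
    ‖toEnveloping a‖ ≤ ‖ρ.l1Hom a‖ := by
  have hc : Continuous (toEnveloping : L1 α hα →⋆ₐ[ℂ] CrossedProduct α hα) :=
    AddMonoidHomClass.continuous_of_bound _ 1 fun a => by
      rw [one_mul]; exact _root_.norm_toEnveloping_le a
  exact le_of_tendsto_of_tendsto' ((hc.norm.tendsto a).comp a.tendsto_restrict)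
    ((ρ.continuous_l1Hom.norm.tendsto a).comp a.tendsto_restrict) fun s =>
      h.norm_toEnveloping_le_of_supportedOn (L1.supportedOn_restrict s a)

/-- The lower bound on the dense image of `ℓ¹(Γ, α, A)` is a closed condition, so it holds on the
whole crossed product and leaves no kernel. -/
theorem PropertyStar.injective (h : ρ.PropertyStar) : Function.Injective ρ.integrated := by
  have hc : Continuous ρ.integrated := AddMonoidHomClass.continuous_of_bound _ 1 fun x => by
    rw [one_mul]; exact NonUnitalStarAlgHom.norm_apply_le ρ.integrated x
  have hle (x : CrossedProduct α hα) : ‖x‖ ≤ ‖ρ.integrated x‖ := by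
    refine (CStarSeminorm.denseRange_toCompl _).induction_on
      (p := fun x : CrossedProduct α hα => ‖x‖ ≤ ‖ρ.integrated x‖) x
      (isClosed_le continuous_norm hc.norm) fun a => ?_
    have := h.norm_toEnveloping_le a
    rwa [← integrated_toEnveloping] at this
  refine (injective_iff_map_eq_zero ρ.integrated).2 fun x hx => ?_
  have := hle x
  rw [hx, norm_zero] at this
  exact norm_le_zero_iff.1 this

end CovariantRep

end CrossedProduct

end

theorem theorem6p2 {Γ : Type u} {A : Type v} [AddCommGroup Γ] [LinearOrder Γ]
    [IsOrderedAddMonoid Γ] [CStarAlgebra A] (α : EndAction Γ A)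
    (hα : IsFinelyRepresentable.{u, v, w} α)
    {H : Type w'} [NormedAddCommGroup H] [InnerProductSpace ℂ H] [CompleteSpace H]
    (ρ : CovariantRep α hα.transfer H) :
    Function.Injective ρ.integrated ↔ ρ.PropertyStar :=
  ⟨ρ.propertyStar_of_injective, fun h => h.injective⟩
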